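/- Let $V,W$ be real vector spaces of finite dimensions $m$ and $n$. Conventions. A cone in a finite-dimensional real vector space $E$ is a subset closed under nonnegative linear combinations. A face of a cone $C$ is a cone $F\subseteq C$ such that $c_1,c_2\in C$ and $c_1+c_2\in F$ imply $c_1,c_2\in F$; it is exposed if $F=C\cap\ker\phi$ for some linear functional $\phi$ on $E$ with $\phi\geq 0$ on $C$. A cone $C$ in $E$ is almost compact if it is closed, spans $E$, and is pointed, i.e. $\{0\}$ is an exposed face of $C$. For a real vector space $U$, $S_+(U)\subseteq \operatorname{Sym}^2(U)$ is the cone of sums of squares. For cones $C\subseteq E$, $D\subseteq E'$ let $C\otimes D\subseteq E\otimes E'$ be the convex cone generated by all $c\otimes d$ with $c\in C$, $d\in D$; let $\operatorname{Hom}(C,D)$ be the cone of linear maps $f:E\to E'$ with $f(C)\subseteq D$; and let $\operatorname{Sym}^2(C)\subseteq\operatorname{Sym}^2(E)$ be the convex cone generated by all $c_1c_2$ with $c_1,c_2\in C$. An almost compact cone $C$ in $E$ is a spectrahedral cone if $C=\psi^{-1}(S_+(U^*))$ for some finite-dimensional $U$ and some injective linear map $\psi:E\to\operatorname{Sym}^2(U^*)$;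 an almost compact cone is an SDR cone if it is the image of a spectrahedral cone under a linear map. A spectrahedron in $E$ is a set $\{x\in E: A+B(x)\succeq 0\}$ and an SDR set in $E$ is a set $\{x\in E:\exists y\in\mathbb{R}^l,\ A+B(x)+C(y)\succeq 0\}$, where $A$ is a real symmetric matrix and $B,C$ are linear maps into symmetric matrices of the same size. Theorem. 1. If $\min(m,n)\leq 2$, then $S_+(V)\otimes S_+(W)$ is a spectrahedral cone (in particular a spectrahedron), and $\operatorname{Hom}(S_+(V),S_+(W))$ is an SDR cone and an SDR set. 2. If $m\leq 2$, then $\operatorname{Sym}^2(S_+(V))$ is an SDR cone and an SDR set. 3. If $m=n=3$, then $S_+(V)\otimes S_+(W)$ has a non-exposed face; moreover it is not a spectrahedron, and in particular not a spectrahedral cone. -/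

import Mathlib

open Module
open scoped TensorProduct

noncomputable section

namespace ConeFunctors

variable {E F : Type*} [AddCommGroup E] [Module ℝ E] [AddCommGroup F] [Module ℝ F]

/-- `F` is the exposed face of the cone `C` cut out by some witness: a linear functional that is
nonnegative on `C` and vanishes on exactly the points of `F` among the points of `C`. -/
def IsExposedFace (F C : PointedCone ℝ E) : Prop :=
  ∃ φ : Dual ℝ E, (∀ c ∈ C, 0 ≤ φ c) ∧ (F : Set E) = {c | c ∈ C ∧ φ c = 0}

/-- Almost compact cones: pointed (the origin is an exposed face), closed, full-dimensional
convex cones in a finite-dimensional real vector space. The module topology of a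
finite-dimensional real vector space is its Euclidean topology. -/
structure IsAlmostCompact (C : PointedCone ℝ E) : Prop where
  finite : FiniteDimensional ℝ E
  pointed : IsExposedFace ⊥ C
  closed : @IsClosed E (moduleTopology ℝ E) (C : Set E)
  full : Submodule.span ℝ (C : Set E) = ⊤

/-- The `p`-th symmetric power of a cone: the convex cone generated by the products
`v₁ ⋯ v_p` with all `v_i` in the cone. -/
def symPower (p : ℕ) (C : PointedCone ℝ E) : PointedCone ℝ (Sym[ℝ]^p E) :=
  PointedCone.hull ℝ {x | ∃ v : Fin p → E, (∀ i, v i ∈ C) ∧ x = SymmetricPower.tprod ℝ v}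

/-- The cone of linear maps that send the cone `C` into the cone `D`. -/
def homCone (C : PointedCone ℝ E) (D : PointedCone ℝ F) : PointedCone ℝ (E →ₗ[ℝ] F) where
  carrier := {f | ∀ c ∈ C, f c ∈ D}
  add_mem' hf hg c hc := D.add_mem (hf c hc) (hg c hc)
  zero_mem' _ _ := D.zero_mem
  smul_mem' a _ hf c hc := Submodule.smul_mem D a (hf c hc)

/-- The cone `S₊(V)` of sums of squares `v²` in `Sym² V`. A nonnegative multiple of a square is a
square, so the cone generated by the squares is the set of sums of squares. -/
def psdCone (V : Type*) [AddCommGroup V] [Module ℝ V] : PointedCone ℝ (Sym[ℝ]^2 V) :=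
  PointedCone.hull ℝ (Set.range fun v : V => SymmetricPower.tprod ℝ fun _ : Fin 2 => v)

/-- Spectrahedral cones: almost compact cones that are the preimage of a cone `S₊(U*)` under an
injective linear map, `U` a finite-dimensional real vector space. -/
def IsSpectrahedralCone (C : PointedCone ℝ E) : Prop :=
  IsAlmostCompact C ∧ ∃ (k : ℕ) (ψ : E →ₗ[ℝ] Sym[ℝ]^2 (Dual ℝ (Fin k → ℝ))),
    Function.Injective ψ ∧ C = (psdCone (Dual ℝ (Fin k → ℝ))).comap ψ

/-- SDR cones: almost compact cones that are the image of a spectrahedral cone under a linear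
map. -/
def IsSDRCone (D : PointedCone ℝ E) : Prop :=
  IsAlmostCompact D ∧ ∃ (k : ℕ) (C : PointedCone ℝ (Fin k → ℝ)) (π : (Fin k → ℝ) →ₗ[ℝ] E),
    IsSpectrahedralCone C ∧ C.map π = D

/-- Spectrahedra: solution sets of a linear matrix inequality `A + B x ⪰ 0`, with `A` symmetric
and `B` linear with symmetric values. -/
def IsSpectrahedron (S : Set E) : Prop :=
  ∃ (k : ℕ) (A : Matrix (Fin k) (Fin k) ℝ) (B : E →ₗ[ℝ] Matrix (Fin k) (Fin k) ℝ),
    A.IsSymm ∧ (∀ x, (B x).IsSymm) ∧ S = {x | (A + B x).PosSemidef}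

/-- SDR sets: sets of the form `{x | ∃ y ∈ ℝˡ, A + B x + C y ⪰ 0}`, with `A` symmetric and `B`,
`C` linear with symmetric values. -/
def IsSDRSet (S : Set E) : Prop :=
  ∃ (k l : ℕ) (A : Matrix (Fin k) (Fin k) ℝ) (B : E →ₗ[ℝ] Matrix (Fin k) (Fin k) ℝ)
    (C : (Fin l → ℝ) →ₗ[ℝ] Matrix (Fin k) (Fin k) ℝ),
    A.IsSymm ∧ (∀ x, (B x).IsSymm) ∧ (∀ y, (C y).IsSymm) ∧
      S = {x | ∃ y, (A + B x + C y).PosSemidef}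

end ConeFunctors

end

open ConeFunctors

noncomputable section

namespace ConeFunctors

/-!
Elements of `Sym² V ⊗ Sym² W` are matrices that are invariant under partial transposition. If one of
the factors has dimension at most two, such a matrix lies in `S₊(V) ⊗ S₊(W)` as soon as it is
positive semidefinite, by simultaneous diagonalization of its blocks; this is a linear matrix
inequality. By duality, `Hom(S₊(V), S₊(W))` is then the image of `S₊(V → W)` under the map that
sends `a a'` to `v² ↦ (a v)(a' v)`. Multiplication maps `S₊(V) ⊗ S₊(V)` onto `Sym² (S₊(V))`.

In dimension three, the nonnegative biquadratic form `ckl` vanishes at ten points. The tensor `q` of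
the tenth zero is a sum of tangent vectors, at the other nine, of the variety of all `v² ⊗ w²`. A
functional that is nonnegative on the cone and vanishes at a point of this variety vanishes on the
tangent space there, so each exposed face that contains the other nine tensors contains `q`. But the
pair (`ckl`, `cklSep`) with a second form is lexicographically nonnegative on the cone, both forms
vanish at the nine zeros, and `cklSep` is positive at `q`. So `q` is not in the smallest face that
contains the nine, and this face is not exposed. Faces of spectrahedra are exposed.
-/

section SymmetricSquare

variable {V F : Type*} [AddCommGroup V] [Module ℝ V] [AddCommGroup F] [Module ℝ F]

/-- The product `x y` in the symmetric square, as a bilinear map. -/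
def symMul : V →ₗ[ℝ] V →ₗ[ℝ] Sym[ℝ]^2 V :=
  (MultilinearMap.ofSubsingletonₗ ℝ ℝ V (Sym[ℝ]^2 V) (0 : Fin 1)).symm.toLinearMap ∘ₗ
    (SymmetricPower.tprod ℝ (ι := Fin 2) (M := V)).curryLeft

theorem tprod_eq_symMul (v : Fin 2 → V) : SymmetricPower.tprod ℝ v = symMul (v 0) (v 1) :=
  congrArg (SymmetricPower.tprod ℝ) (by ext i; fin_cases i <;> rfl)

theorem symMul_comm (x y : V) : symMul x y = symMul y x := by
  have h := SymmetricPower.tprod_equiv (R := ℝ) (Equiv.swap (0 : Fin 2) 1) ![x, y]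
  rw [tprod_eq_symMul, tprod_eq_symMul] at h
  exact h.symm

theorem symMul_polarization (x y : V) :
    symMul x y = (1 / 4 : ℝ) • (symMul (x + y) (x + y) - symMul (x - y) (x - y)) := by
  simp only [map_add, map_sub, LinearMap.add_apply, LinearMap.sub_apply, symMul_comm y x]
  module

theorem span_range_symMul_self :
    Submodule.span ℝ (Set.range fun x : V => symMul x x) = ⊤ := by
  rw [eq_top_iff, ← SymmetricPower.span_tprod_eq_top, Submodule.span_le]
  rintro _ ⟨v, rfl⟩
  rw [tprod_eq_symMul, symMul_polarization]
  exact Submodule.smul_mem _ _ (Submodule.sub_mem _ (Submodule.subset_span ⟨_, rfl⟩)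
    (Submodule.subset_span ⟨_, rfl⟩))

theorem symmetricSquare_hom_ext {f g : Sym[ℝ]^2 V →ₗ[ℝ] F}
    (h : ∀ x, f (symMul x x) = g (symMul x x)) : f = g :=
  LinearMap.ext_on_range span_range_symMul_self h

/-- The linear map out of the symmetric square induced by a symmetric bilinear map. -/
def symLift (B : V →ₗ[ℝ] V →ₗ[ℝ] F) (hB : ∀ x y, B x y = B y x) : Sym[ℝ]^2 V →ₗ[ℝ] F :=
  let L : (⨂[ℝ] _ : Fin 2, V) →ₗ[ℝ] F := PiTensorProduct.lift <| LinearMap.uncurryLeft <|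
    (MultilinearMap.ofSubsingletonₗ ℝ ℝ V F (0 : Fin 1)).toLinearMap ∘ₗ B
  have hL : addConGen (SymmetricPower.Rel ℝ (Fin 2) V) ≤ AddCon.ker L.toAddMonoidHom := by
    refine AddCon.addConGen_le.2 ?_
    rintro _ _ ⟨e, v⟩
    change L (PiTensorProduct.tprod ℝ v) = L (PiTensorProduct.tprod ℝ fun i => v (e i))
    simp only [L, PiTensorProduct.lift.tprod]
    change B (v 0) (v 1) = B (v (e 0)) (v (e 1))
    rcases (by decide +revert : (e 0 = 0 ∧ e 1 = 1) ∨ (e 0 = 1 ∧ e 1 = 0)) with ⟨h0, h1⟩ | ⟨h0, h1⟩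
    · rw [h0, h1]
    · rw [h0, h1, hB]
  { AddCon.lift _ L.toAddMonoidHom hL with
    map_smul' := fun a s => by
      induction s using AddCon.induction_on with
      | H s => exact L.map_smul a s }

@[simp]
theorem symLift_symMul (B : V →ₗ[ℝ] V →ₗ[ℝ] F) (hB : ∀ x y, B x y = B y x) (x y : V) :
    symLift B hB (symMul x y) = B x y := by
  change PiTensorProduct.lift _ (PiTensorProduct.tprod ℝ fun i : Fin 2 =>
    (Fin.cons x (fun _ : Fin 1 => y) : Fin 2 → V) i) = _
  rw [PiTensorProduct.lift.tprod]
  rfl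

theorem symMul_self_mem_psdCone (v : V) : symMul v v ∈ psdCone V :=
  Submodule.subset_span ⟨v, tprod_eq_symMul _⟩

theorem psdCone_eq_hull : psdCone V = PointedCone.hull ℝ (Set.range fun v : V => symMul v v) := by
  simp only [psdCone, tprod_eq_symMul]

theorem span_psdCone : Submodule.span ℝ (psdCone V : Set (Sym[ℝ]^2 V)) = ⊤ := by
  rw [eq_top_iff, ← span_range_symMul_self]
  refine Submodule.span_mono ?_
  rintro _ ⟨v, rfl⟩
  exact symMul_self_mem_psdCone v

variable {ι : Type*} [Fintype ι]

/-- The bilinear map sending `x` and `y` to the rank one matrix `x yᵀ` of their coordinates. -/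
def coordOuter (b : Basis ι ℝ V) : V →ₗ[ℝ] V →ₗ[ℝ] Matrix ι ι ℝ :=
  LinearMap.mk₂ ℝ (fun x y => Matrix.vecMulVec (b.equivFun x) (b.equivFun y))
    (fun x x' y => by rw [map_add, Matrix.add_vecMulVec])
    (fun a x y => by rw [map_smul, Matrix.smul_vecMulVec])
    (fun x y y' => by rw [map_add, Matrix.vecMulVec_add])
    (fun a x y => by rw [map_smul, Matrix.vecMulVec_smul])

/-- The symmetric matrix of an element of the symmetric square with respect to a basis, normalized
so that the matrix of a square `x x` is the rank one matrix of the coordinate vector of `x`. -/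
def symMat (b : Basis ι ℝ V) : Sym[ℝ]^2 V →ₗ[ℝ] Matrix ι ι ℝ :=
  symLift ((1 / 2 : ℝ) • (coordOuter b + (coordOuter b).flip)) fun x y => by
    simp only [LinearMap.smul_apply, LinearMap.add_apply, LinearMap.flip_apply]
    rw [add_comm]

theorem symMat_symMul (b : Basis ι ℝ V) (x y : V) :
    symMat b (symMul x y) = (1 / 2 : ℝ) • (Matrix.vecMulVec (b.equivFun x) (b.equivFun y) +
      Matrix.vecMulVec (b.equivFun y) (b.equivFun x)) := by
  simp [symMat, coordOuter]

theorem symMat_symMul_self (b : Basis ι ℝ V) (x : V) :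
    symMat b (symMul x x) = Matrix.vecMulVec (b.equivFun x) (b.equivFun x) := by
  rw [symMat_symMul]
  module

theorem isSymm_symMat (b : Basis ι ℝ V) (s : Sym[ℝ]^2 V) : (symMat b s).IsSymm := by
  suffices (Matrix.transposeLinearEquiv ι ι ℝ ℝ).toLinearMap ∘ₗ symMat b = symMat b from
    LinearMap.congr_fun this s
  refine symmetricSquare_hom_ext fun x => ?_
  simp [symMat_symMul_self, Matrix.transpose_vecMulVec]

/-- The element `∑ A i j • b i * b j` of the symmetric square. -/
def matSym (b : Basis ι ℝ V) : Matrix ι ι ℝ →ₗ[ℝ] Sym[ℝ]^2 V where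
  toFun A := ∑ i, ∑ j, A i j • symMul (b i) (b j)
  map_add' A B := by simp [add_smul, Finset.sum_add_distrib]
  map_smul' a A := by simp [mul_smul, Finset.smul_sum]

theorem matSym_vecMulVec (b : Basis ι ℝ V) (x y : ι → ℝ) :
    matSym b (Matrix.vecMulVec x y) = symMul (b.equivFun.symm x) (b.equivFun.symm y) := by
  simp only [matSym, LinearMap.coe_mk, AddHom.coe_mk, Matrix.vecMulVec_apply,
    Basis.equivFun_symm_apply, map_sum, map_smul, LinearMap.sum_apply, LinearMap.smul_apply,
    Finset.smul_sum, smul_smul]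
  rw [Finset.sum_comm]
  simp only [mul_comm]

theorem matSym_symMat (b : Basis ι ℝ V) (s : Sym[ℝ]^2 V) : matSym b (symMat b s) = s := by
  suffices matSym b ∘ₗ symMat b = LinearMap.id from LinearMap.congr_fun this s
  refine symmetricSquare_hom_ext fun x => ?_
  simp [symMat_symMul_self, matSym_vecMulVec]

theorem symMat_injective (b : Basis ι ℝ V) : Function.Injective (symMat b) :=
  Function.LeftInverse.injective (matSym_symMat b)

theorem symMat_matSym (b : Basis ι ℝ V) {A : Matrix ι ι ℝ} (hA : A.IsSymm) :
    symMat b (matSym b A) = A := by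
  classical
  have hlin : symMat b ∘ₗ matSym b =
      (1 / 2 : ℝ) • (LinearMap.id + (Matrix.transposeLinearEquiv ι ι ℝ ℝ).toLinearMap) := by
    refine Matrix.ext_linearMap ℝ fun i j => LinearMap.ext_ring ?_
    have hsingle : Matrix.single i j (1 : ℝ) = Matrix.vecMulVec (Pi.single i 1) (Pi.single j 1) :=
      Matrix.single_eq_single_vecMulVec_single i j
    change symMat b (matSym b (Matrix.single i j 1)) =
      (1 / 2 : ℝ) • (Matrix.single i j 1 + (Matrix.single i j 1).transpose)
    rw [hsingle, matSym_vecMulVec, symMat_symMul, LinearEquiv.apply_symm_apply,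
      LinearEquiv.apply_symm_apply, Matrix.transpose_vecMulVec]
  calc symMat b (matSym b A) = (1 / 2 : ℝ) • (A + A.transpose) := LinearMap.congr_fun hlin A
    _ = A := by rw [hA.eq]; module

instance [FiniteDimensional ℝ V] : FiniteDimensional ℝ (Sym[ℝ]^2 V) :=
  FiniteDimensional.of_injective (symMat (finBasis ℝ V)) (symMat_injective _)

theorem posSemidef_vecMulVec_self {κ : Type*} [Finite κ] (v : κ → ℝ) :
    (Matrix.vecMulVec v v).PosSemidef := by
  simpa using Matrix.posSemidef_vecMulVec_self_star v

/-- The cone of positive semidefinite matrices. -/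
def posSemidefCone (ι : Type*) : PointedCone ℝ (Matrix ι ι ℝ) where
  carrier := {A | A.PosSemidef}
  add_mem' := Matrix.PosSemidef.add
  zero_mem' := Matrix.PosSemidef.zero
  smul_mem' a _ hA := hA.smul a.2

theorem psdCone_eq_comap_symMat (b : Basis ι ℝ V) :
    psdCone V = (posSemidefCone ι).comap (symMat b) := by
  refine le_antisymm ?_ fun s hs => ?_
  · rw [psdCone_eq_hull, PointedCone.hull, Submodule.span_le]
    rintro _ ⟨v, rfl⟩
    change (symMat b (symMul v v)).PosSemidef
    rw [symMat_symMul_self]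
    exact posSemidef_vecMulVec_self _
  · have hpsd : (symMat b s).PosSemidef := hs
    obtain ⟨m, v, hv⟩ := Matrix.posSemidef_iff_eq_sum_vecMulVec.1 hpsd
    rw [← matSym_symMat b s, hv, map_sum]
    refine Submodule.sum_mem _ fun k _ => ?_
    rw [star_trivial, matSym_vecMulVec]
    exact symMul_self_mem_psdCone _

theorem mem_psdCone_iff (b : Basis ι ℝ V) (s : Sym[ℝ]^2 V) :
    s ∈ psdCone V ↔ (symMat b s).PosSemidef := by
  rw [psdCone_eq_comap_symMat b]
  rfl

end SymmetricSquare

section SimultaneousDiagonalization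

variable {ι κ : Type*}

theorem isSymm_of_posSemidef {A : Matrix ι ι ℝ} (hA : A.PosSemidef) : A.IsSymm := by
  simpa [Matrix.IsHermitian, Matrix.IsSymm] using hA.isHermitian

variable [Fintype ι]

theorem mulVec_eq_zero_of_posSemidef_fromBlocks [Finite κ] {A : Matrix ι ι ℝ} {B : Matrix ι κ ℝ}
    {C : Matrix κ ι ℝ} {D : Matrix κ κ ℝ} (h : (Matrix.fromBlocks A B C D).PosSemidef)
    {z : ι → ℝ} (hz : A.mulVec z = 0) : C.mulVec z = 0 := by
  classical
  cases nonempty_fintype κ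
  have hmul : (Matrix.fromBlocks A B C D).mulVec (Sum.elim z 0) =
      Sum.elim (0 : ι → ℝ) (C.mulVec z) := by
    simp [Matrix.fromBlocks_mulVec, hz]
  have hzero : (Matrix.fromBlocks A B C D).mulVec (Sum.elim z 0) = 0 := by
    rw [← h.dotProduct_mulVec_zero_iff, hmul]
    simp [dotProduct]
  exact funext fun k => congrFun (hmul.symm.trans hzero) (Sum.inr k)

variable [DecidableEq ι]

theorem exists_orthogonal_diagonalization {A : Matrix ι ι ℝ} (hA : A.IsSymm) :
    ∃ (U : Matrix ι ι ℝ) (d : ι → ℝ), U.transpose * U = 1 ∧ U * U.transpose = 1 ∧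
      A = U * Matrix.diagonal d * U.transpose := by
  have hA' : A.IsHermitian := by
    rwa [Matrix.IsHermitian, Matrix.conjTranspose_eq_transpose_of_trivial]
  have hU := Unitary.star_mul_self_of_mem hA'.eigenvectorUnitary.2
  have hU' := Unitary.mul_star_self_of_mem hA'.eigenvectorUnitary.2
  rw [Matrix.star_eq_conjTranspose, Matrix.conjTranspose_eq_transpose_of_trivial] at hU hU'
  refine ⟨hA'.eigenvectorUnitary, hA'.eigenvalues, hU, hU', ?_⟩
  conv_lhs => rw [hA'.spectral_theorem]
  rw [Unitary.conjStarAlgAut_apply, Matrix.star_eq_conjTranspose,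
    Matrix.conjTranspose_eq_transpose_of_trivial]
  rfl

theorem posSemidef_mul_diagonal_mul_transpose [Finite κ] (W : Matrix κ ι ℝ) {d : ι → ℝ}
    (hd : ∀ i, 0 ≤ d i) : (W * Matrix.diagonal d * W.transpose).PosSemidef := by
  rw [← Matrix.conjTranspose_eq_transpose_of_trivial]
  exact (Matrix.PosSemidef.diagonal hd).mul_mul_conjTranspose_same W

theorem exists_congruence_diagonal {a : ι → ℝ} (ha : ∀ i, 0 ≤ a i) {B : Matrix ι ι ℝ}
    (hB : B.IsSymm) (hker : ∀ i j, a j = 0 → B i j = 0) :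
    ∃ (W Q : Matrix ι ι ℝ) (d : ι → ℝ), Matrix.diagonal a = W * W.transpose ∧
      B = Q * Matrix.diagonal a ∧ Q * W = W * Matrix.diagonal d := by
  let s : ι → ℝ := fun i => √(a i)
  let t : ι → ℝ := fun i => (s i)⁻¹
  have hss (i : ι) : s i * s i = a i := Real.mul_self_sqrt (ha i)
  have hts (i : ι) : t i * (t i * s i) = t i := by
    simpa [t, mul_comm] using mul_inv_mul_cancel (s i)⁻¹
  have hst (i j : ι) : s i * t i * B i j = B i j := by
    rcases eq_or_ne (s i) 0 with hi | hi
    · rw [hi, zero_mul, zero_mul, ← hB.apply, hker j i (by rw [← hss, hi, zero_mul])]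
    · rw [mul_inv_cancel₀ hi, one_mul]
  let X : Matrix ι ι ℝ := Matrix.diagonal t * B * Matrix.diagonal t
  have hX : X.IsSymm := by
    simp [X, Matrix.IsSymm, Matrix.transpose_mul, hB.eq, mul_assoc]
  obtain ⟨V, d, hV, hV', hXV⟩ := exists_orthogonal_diagonalization hX
  refine ⟨Matrix.diagonal s * V, Matrix.diagonal s * X * Matrix.diagonal t, d, ?_, ?_, ?_⟩
  · calc Matrix.diagonal a = Matrix.diagonal s * (V * V.transpose) * Matrix.diagonal s := by
          simp [hV', Matrix.diagonal_mul_diagonal, hss]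
      _ = _ := by simp only [Matrix.transpose_mul, Matrix.diagonal_transpose, mul_assoc]
  · ext i j
    simp only [X, Matrix.diagonal_mul, Matrix.mul_diagonal]
    have hj := hst j i
    rw [hB.apply] at hj
    calc B i j = s j * t j * (s j * t j * (s i * t i * B i j)) := by rw [hst i j, hj, hj]
      _ = s i * (t i * B i j * t j) * t j * a j := by rw [← hss j]; ring
  · calc Matrix.diagonal s * X * Matrix.diagonal t * (Matrix.diagonal s * V)
        = Matrix.diagonal s * (Matrix.diagonal t * B *
            (Matrix.diagonal t * (Matrix.diagonal t * Matrix.diagonal s))) * V := by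
          simp only [X, mul_assoc]
      _ = Matrix.diagonal s * X * V := by
          simp only [Matrix.diagonal_mul_diagonal, hts, X]
      _ = Matrix.diagonal s * (V * Matrix.diagonal d * (V.transpose * V)) := by
          rw [hXV]; simp only [mul_assoc]
      _ = Matrix.diagonal s * V * Matrix.diagonal d := by rw [hV, mul_one, mul_assoc]

/-- A symmetric `B` whose kernel contains that of a positive semidefinite `A` factors as `Q A`, and
`Q` is self-adjoint for the semidefinite form `A`, hence diagonalizable on its range. -/
theorem exists_simultaneous_diagonalization {A B : Matrix ι ι ℝ} (hA : A.PosSemidef)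
    (hB : B.IsSymm) (hker : ∀ z, A.mulVec z = 0 → B.mulVec z = 0) :
    ∃ (W Q : Matrix ι ι ℝ) (d : ι → ℝ), A = W * W.transpose ∧ B = Q * A ∧
      Q * W = W * Matrix.diagonal d := by
  obtain ⟨U, a, hU, hU', hAU⟩ := exists_orthogonal_diagonalization (isSymm_of_posSemidef hA)
  have hUAU : U.transpose * A * U = Matrix.diagonal a := by
    calc _ = U.transpose * U * Matrix.diagonal a * (U.transpose * U) := by
          rw [hAU]; simp only [mul_assoc]
      _ = _ := by rw [hU, one_mul, mul_one]
  have ha : ∀ i, 0 ≤ a i := by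
    have h := hA.conjTranspose_mul_mul_same U
    rwa [Matrix.conjTranspose_eq_transpose_of_trivial, hUAU, Matrix.posSemidef_diagonal_iff] at h
  have hBU : (U.transpose * B * U).IsSymm := by
    simp [Matrix.IsSymm, Matrix.transpose_mul, hB.eq, mul_assoc]
  have hcol (i j : ι) (hj : a j = 0) : (U.transpose * B * U) i j = 0 := by
    have hAj : A.mulVec (U.col j) = 0 := by
      have h : A * U = U * Matrix.diagonal a := by
        rw [hAU, mul_assoc, hU, mul_one]
      ext k
      change (A * U) k j = 0
      rw [h, Matrix.mul_diagonal, hj, mul_zero]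
    have hBj : ∀ k, (B * U) k j = 0 := fun k => congrFun (hker _ hAj) k
    rw [mul_assoc, Matrix.mul_apply]
    exact Finset.sum_eq_zero fun k _ => by rw [hBj, mul_zero]
  obtain ⟨W, Q, d, hW, hQ, hQW⟩ := exists_congruence_diagonal ha hBU hcol
  refine ⟨U * W, U * Q * U.transpose, d, ?_, ?_, ?_⟩
  · rw [hAU, hW, Matrix.transpose_mul]
    simp only [mul_assoc]
  · calc B = U * U.transpose * B * (U * U.transpose) := by rw [hU', one_mul, mul_one]
      _ = U * (U.transpose * B * U) * U.transpose := by simp only [mul_assoc]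
      _ = U * Q * (U.transpose * A * U) * U.transpose := by rw [hQ, hUAU]; simp only [mul_assoc]
      _ = U * Q * U.transpose * A * (U * U.transpose) := by simp only [mul_assoc]
      _ = U * Q * U.transpose * A := by rw [hU', mul_one]
  · calc U * Q * U.transpose * (U * W) = U * Q * (U.transpose * U) * W := by simp only [mul_assoc]
      _ = U * W * Matrix.diagonal d := by rw [hU, mul_one, mul_assoc, hQW, ← mul_assoc]

theorem exists_posSemidef_sub_smul {n : Type*} [Fintype n] {A B : Matrix n n ℝ}
    (hA : A.PosSemidef) (hB : B.IsSymm)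
    (hker : ∀ z, A.mulVec z = 0 → B.mulVec z = 0) :
    ∃ ε : ℝ, 0 < ε ∧ (A - ε • B).PosSemidef := by
  classical
  obtain ⟨W, Q, d, hW, hQ, hQW⟩ := exists_simultaneous_diagonalization hA hB hker
  have hpos : 0 < 1 + ∑ i, |d i| := by positivity
  refine ⟨(1 + ∑ i, |d i|)⁻¹, inv_pos.2 hpos, ?_⟩
  have hsub : A - (1 + ∑ i, |d i|)⁻¹ • B =
      W * Matrix.diagonal (fun i => 1 - (1 + ∑ i, |d i|)⁻¹ * d i) * W.transpose := by
    have hdiag : Matrix.diagonal (fun i => 1 - (1 + ∑ i, |d i|)⁻¹ * d i) =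
        1 - (1 + ∑ i, |d i|)⁻¹ • Matrix.diagonal d := by
      rw [← Matrix.diagonal_one, ← Matrix.diagonal_smul, ← Matrix.diagonal_sub]
      rfl
    rw [hdiag, hQ, hW, ← mul_assoc Q, hQW]
    simp only [mul_sub, sub_mul, mul_one, mul_smul_comm, smul_mul_assoc]
  rw [hsub]
  refine posSemidef_mul_diagonal_mul_transpose W fun i => ?_
  have hle : d i ≤ 1 + ∑ i, |d i| := by
    have := Finset.single_le_sum (fun j _ => abs_nonneg (d j)) (Finset.mem_univ i)
    linarith [le_abs_self (d i)]
  rw [inv_mul_eq_div, sub_nonneg, div_le_one hpos]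
  exact hle

theorem exists_congruence_of_posSemidef_fromBlocks {A B C : Matrix ι ι ℝ} (hB : B.IsSymm)
    (h : (Matrix.fromBlocks A B B C).PosSemidef) :
    ∃ (W : Matrix ι ι ℝ) (d : ι → ℝ), A = W * W.transpose ∧
      B = W * Matrix.diagonal d * W.transpose ∧
      (C - W * Matrix.diagonal (fun i => d i ^ 2) * W.transpose).PosSemidef := by
  have hA : A.PosSemidef := h.submatrix Sum.inl
  obtain ⟨W, Q, d, hW, hQ, hQW⟩ := exists_simultaneous_diagonalization hA hB
    fun _ => mulVec_eq_zero_of_posSemidef_fromBlocks h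
  refine ⟨W, d, hW, by rw [hQ, hW, ← mul_assoc, hQW], ?_⟩
  have hWd : W * Matrix.diagonal (fun i => d i ^ 2) * W.transpose = Q * B := by
    have : Matrix.diagonal (fun i => d i ^ 2) = Matrix.diagonal d * Matrix.diagonal d := by
      simp only [Matrix.diagonal_mul_diagonal, sq]
    rw [this, hQ, hW, ← mul_assoc, ← hQW, ← mul_assoc, ← mul_assoc, mul_assoc Q W, ← hQW]
    simp only [mul_assoc]
  let R : Matrix ι (ι ⊕ ι) ℝ := Matrix.fromCols (-Q) 1
  have hschur : R * Matrix.fromBlocks A B B C * R.transpose =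
      C - W * Matrix.diagonal (fun i => d i ^ 2) * W.transpose := by
    simp only [R, Matrix.transpose_fromCols, Matrix.fromCols_mul_fromBlocks,
      Matrix.fromCols_mul_fromRows, Matrix.transpose_neg, Matrix.transpose_one, neg_mul, one_mul,
      mul_one, ← hQ, neg_add_cancel, Matrix.zero_mul, zero_add, hWd]
    abel
  rw [← hschur, ← Matrix.conjTranspose_eq_transpose_of_trivial]
  exact h.mul_mul_conjTranspose_same R

end SimultaneousDiagonalization

section Separable

open scoped Kronecker

variable {ι κ : Type*}

/-- The cone of separable matrices, generated by the Kronecker products of rank one positive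
semidefinite matrices. -/
def sepCone (ι κ : Type*) : PointedCone ℝ (Matrix (ι × κ) (ι × κ) ℝ) :=
  PointedCone.hull ℝ (Set.range fun p : (ι → ℝ) × (κ → ℝ) =>
    Matrix.vecMulVec p.1 p.1 ⊗ₖ Matrix.vecMulVec p.2 p.2)

/-- Invariance of a matrix indexed by pairs under transposition of the first factor. -/
def IsPartialTransposeInvariant (ρ : Matrix (ι × κ) (ι × κ) ℝ) : Prop :=
  ∀ i j k l, ρ (i, k) (j, l) = ρ (j, k) (i, l)

theorem kronecker_mem_sepCone [Finite ι] [Finite κ] {A : Matrix ι ι ℝ} {B : Matrix κ κ ℝ}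
    (hA : A.PosSemidef) (hB : B.PosSemidef) : A ⊗ₖ B ∈ sepCone ι κ := by
  have := Fintype.ofFinite ι
  have := Fintype.ofFinite κ
  obtain ⟨m, v, rfl⟩ := Matrix.posSemidef_iff_eq_sum_vecMulVec.1 hA
  obtain ⟨n, w, rfl⟩ := Matrix.posSemidef_iff_eq_sum_vecMulVec.1 hB
  change Matrix.kroneckerBilinear (R := ℝ)
    (∑ i, Matrix.vecMulVec (v i) (star (v i))) (∑ i, Matrix.vecMulVec (w i) (star (w i))) ∈ _
  simp only [map_sum, LinearMap.sum_apply, star_trivial]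
  exact Submodule.sum_mem _ fun j _ => Submodule.sum_mem _ fun i _ =>
    Submodule.subset_span ⟨(v i, w j), rfl⟩

theorem sepCone_le_posSemidefCone [Finite ι] [Finite κ] : sepCone ι κ ≤ posSemidefCone (ι × κ) := by
  have := Fintype.ofFinite ι
  have := Fintype.ofFinite κ
  rw [sepCone, PointedCone.hull, Submodule.span_le]
  rintro _ ⟨p, rfl⟩
  exact (posSemidef_vecMulVec_self p.1).kronecker (posSemidef_vecMulVec_self p.2)

theorem mem_sepCone_of_swap {ρ : Matrix (ι × κ) (ι × κ) ℝ}
    (h : ρ.submatrix Prod.swap Prod.swap ∈ sepCone κ ι) : ρ ∈ sepCone ι κ := by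
  let e := (Matrix.reindexLinearEquiv ℝ ℝ (Equiv.prodComm κ ι) (Equiv.prodComm κ ι)).toLinearMap
  suffices sepCone κ ι ≤ (sepCone ι κ).comap e from this h
  rw [sepCone, PointedCone.hull, Submodule.span_le]
  rintro _ ⟨⟨v, w⟩, rfl⟩
  refine Submodule.subset_span ⟨(w, v), ?_⟩
  ext p q
  exact mul_comm _ _

theorem mem_sepCone_of_subsingleton [Subsingleton ι] [Finite κ] {ρ : Matrix (ι × κ) (ι × κ) ℝ}
    (hρ : ρ.PosSemidef) : ρ ∈ sepCone ι κ := by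
  rcases isEmpty_or_nonempty ι with hι | ⟨⟨i⟩⟩
  · rw [Subsingleton.elim ρ 0]
    exact Submodule.zero_mem _
  · have hfactor : ρ = Matrix.vecMulVec 1 1 ⊗ₖ ρ.submatrix (fun k => (i, k)) fun k => (i, k) := by
      ext ⟨j, k⟩ ⟨j', k'⟩
      simp [Subsingleton.elim i j, Subsingleton.elim j' j]
    rw [hfactor]
    have := Fintype.ofFinite ι
    exact kronecker_mem_sepCone (posSemidef_vecMulVec_self 1) (hρ.submatrix _)

theorem mul_diagonal_mul_transpose_apply [Fintype ι] [DecidableEq ι] (W : Matrix κ ι ℝ)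
    (d : ι → ℝ) (k l : κ) :
    (W * Matrix.diagonal d * W.transpose) k l = ∑ i, d i * (W k i * W l i) := by
  rw [Matrix.mul_apply]
  refine Finset.sum_congr rfl fun i _ => ?_
  rw [Matrix.mul_diagonal, Matrix.transpose_apply]
  ring

/-- With two block rows, `ρ` has blocks `A`, `B`, `B`, `C`, and a congruence that diagonalizes `A`
and `B` simultaneously splits it into Kronecker products. -/
theorem mem_sepCone_fin_two [Finite κ] {ρ : Matrix (Fin 2 × κ) (Fin 2 × κ) ℝ}
    (hρ : ρ.PosSemidef) (hpt : IsPartialTransposeInvariant ρ) : ρ ∈ sepCone (Fin 2) κ := by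
  classical
  have := Fintype.ofFinite κ
  have hsymm := isSymm_of_posSemidef hρ
  let block (i j : Fin 2) : Matrix κ κ ℝ := ρ.submatrix (fun k => (i, k)) fun k => (j, k)
  have hB : (block 0 1).IsSymm := by
    ext k l
    exact (hpt _ _ _ _).trans (hsymm.apply _ _)
  have hblocks :
      (Matrix.fromBlocks (block 0 0) (block 0 1) (block 0 1) (block 1 1)).PosSemidef := by
    convert hρ.submatrix (Sum.elim (fun k => ((0 : Fin 2), k)) fun k => ((1 : Fin 2), k)) using 1
    ext (k | k) (l | l)
    · rfl
    · rfl
    · exact hpt 0 1 k l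
    · rfl
  obtain ⟨W, d, hA, hB, hC⟩ := exists_congruence_of_posSemidef_fromBlocks hB hblocks
  set D := block 1 1 - W * Matrix.diagonal (fun i => d i ^ 2) * W.transpose with hD
  have hsplit : ρ =
      (∑ i, Matrix.vecMulVec ![1, d i] ![1, d i] ⊗ₖ Matrix.vecMulVec (W.col i) (W.col i)) +
        Matrix.vecMulVec ![0, 1] ![0, 1] ⊗ₖ D := by
    have h00 (k l : κ) : ρ (0, k) (0, l) = ∑ i, W k i * W l i := by
      simpa [block, Matrix.mul_apply] using congrFun (congrFun hA k) l
    have h01 (k l : κ) : ρ (0, k) (1, l) = ∑ i, d i * (W k i * W l i) := by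
      calc ρ (0, k) (1, l) = (W * Matrix.diagonal d * W.transpose) k l := congrFun (congrFun hB k) l
        _ = _ := mul_diagonal_mul_transpose_apply W d k l
    have h11 (k l : κ) : ρ (1, k) (1, l) = ∑ i, d i * d i * (W k i * W l i) + D k l := by
      rw [hD, Matrix.sub_apply, mul_diagonal_mul_transpose_apply]
      simp [block, sq]
    ext ⟨i, k⟩ ⟨j, l⟩
    simp only [Matrix.add_apply, Matrix.sum_apply, Matrix.kronecker_apply, Matrix.vecMulVec_apply,
      Matrix.col_apply]
    fin_cases i <;> fin_cases j
    · simp [h00]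
    · simp [h01]
    · simp [hpt 1 0, h01]
    · simp [h11]
  rw [hsplit]
  exact Submodule.add_mem _
    (Submodule.sum_mem _ fun i _ => Submodule.subset_span ⟨(![1, d i], W.col i), rfl⟩)
    (kronecker_mem_sepCone (posSemidef_vecMulVec_self _) hC)

theorem mem_sepCone_of_left_le_two {m : ℕ} [Finite κ] (hm : m ≤ 2)
    {ρ : Matrix (Fin m × κ) (Fin m × κ) ℝ} (hρ : ρ.PosSemidef)
    (hpt : IsPartialTransposeInvariant ρ) : ρ ∈ sepCone (Fin m) κ := by
  interval_cases m
  · exact mem_sepCone_of_subsingleton hρ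
  · exact mem_sepCone_of_subsingleton hρ
  · exact mem_sepCone_fin_two hρ hpt

theorem mem_sepCone_of_min_le_two {m n : ℕ} (hmn : min m n ≤ 2)
    {ρ : Matrix (Fin m × Fin n) (Fin m × Fin n) ℝ} (hρ : ρ.PosSemidef)
    (hpt : IsPartialTransposeInvariant ρ) : ρ ∈ sepCone (Fin m) (Fin n) := by
  rcases min_le_iff.1 hmn with hm | hn
  · exact mem_sepCone_of_left_le_two hm hρ hpt
  · refine mem_sepCone_of_swap (mem_sepCone_of_left_le_two hn (hρ.submatrix _) fun i j k l => ?_)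
    exact (hpt _ _ _ _).trans ((isSymm_of_posSemidef hρ).apply _ _)

end Separable

section ClosedCones

variable {E F : Type*} [AddCommGroup E] [Module ℝ E] [AddCommGroup F] [Module ℝ F]

theorem isModuleTopology_of_finiteDimensional [FiniteDimensional ℝ E] [TopologicalSpace E]
    [IsTopologicalAddGroup E] [ContinuousSMul ℝ E] [T2Space E] : IsModuleTopology ℝ E :=
  .iso (finBasis ℝ E).equivFunL.symm

/-- The norm on a finite-dimensional space carried over from the coordinates in some basis. Its
topology is the module topology. -/
abbrev coordNormedAddCommGroup (E : Type*) [AddCommGroup E] [Module ℝ E] [FiniteDimensional ℝ E] :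
    NormedAddCommGroup E :=
  NormedAddCommGroup.induced E _ (finBasis ℝ E).equivFun (finBasis ℝ E).equivFun.injective

/-- Compatibility of the norm `coordNormedAddCommGroup` with scalar multiplication. -/
abbrev coordNormedSpace (E : Type*) [AddCommGroup E] [Module ℝ E] [FiniteDimensional ℝ E] :
    @NormedSpace ℝ E _ (coordNormedAddCommGroup E).toSeminormedAddCommGroup :=
  NormedSpace.induced ℝ E _ (finBasis ℝ E).equivFun

theorem exists_dual_neg_of_notMem [FiniteDimensional ℝ E] {C : PointedCone ℝ E}
    (hC : @IsClosed E (moduleTopology ℝ E) (C : Set E)) {x : E} (hx : x ∉ C) :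
    ∃ l : Dual ℝ E, (∀ c ∈ C, 0 ≤ l c) ∧ l x < 0 := by
  let := coordNormedAddCommGroup E
  let := coordNormedSpace E
  have : IsModuleTopology ℝ E := isModuleTopology_of_finiteDimensional
  rw [← eq_moduleTopology ℝ E] at hC
  obtain ⟨f, hf, hfx⟩ := ProperCone.hyperplane_separation_point ⟨C, hC⟩ hx
  exact ⟨f.toLinearMap, hf, hfx⟩

theorem exists_pos_mul_norm_le {G : Type*} [NormedAddCommGroup G] [NormedSpace ℝ G]
    [FiniteDimensional ℝ G] {C : PointedCone ℝ G} (hC : IsClosed (C : Set G)) {ψ : Dual ℝ G}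
    (hψ : ∀ c ∈ C, c ≠ 0 → 0 < ψ c) : ∃ δ > 0, ∀ c ∈ C, δ * ‖c‖ ≤ ψ c := by
  have := FiniteDimensional.proper_rclike ℝ G
  rcases (Metric.sphere (0 : G) 1 ∩ C).eq_empty_or_nonempty with hempty | hne
  · refine ⟨1, one_pos, fun c hc => ?_⟩
    rcases eq_or_ne c 0 with rfl | hc0
    · simp
    · have : ‖c‖⁻¹ • c ∈ Metric.sphere (0 : G) 1 ∩ C :=
        ⟨by simp [norm_smul, hc0], C.smul_mem (by positivity) hc⟩
      simp [hempty] at this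
  · have hcompact : IsCompact (Metric.sphere (0 : G) 1 ∩ C) := (isCompact_sphere 0 1).inter_right hC
    obtain ⟨u, ⟨hu1, huC⟩, hu⟩ :=
      hcompact.exists_isMinOn hne ψ.continuous_of_finiteDimensional.continuousOn
    have hu0 : u ≠ 0 := by
      rintro rfl
      simp at hu1
    refine ⟨ψ u, hψ u huC hu0, fun c hc => ?_⟩
    rcases eq_or_ne c 0 with rfl | hc0
    · simp
    · have hmin : ψ u ≤ ψ (‖c‖⁻¹ • c) :=
        hu ⟨by simp [norm_smul, hc0], C.smul_mem (by positivity) hc⟩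
      rw [map_smul, smul_eq_mul, inv_mul_eq_div, le_div_iff₀ (norm_pos_iff.2 hc0)] at hmin
      exact hmin

/-- The part of the image below a level of `φ` is the image of a compact set. -/
theorem isClosed_image_of_forall_pos {G H : Type*} [NormedAddCommGroup G] [NormedSpace ℝ G]
    [FiniteDimensional ℝ G] [NormedAddCommGroup H] [NormedSpace ℝ H] [FiniteDimensional ℝ H]
    {C : PointedCone ℝ G} (hC : IsClosed (C : Set G)) (π : G →ₗ[ℝ] H) {φ : Dual ℝ H}
    (hφ : ∀ c ∈ C, c ≠ 0 → 0 < φ (π c)) : IsClosed (π '' (C : Set G)) := by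
  have := FiniteDimensional.proper_rclike ℝ G
  have hφc : Continuous φ := φ.continuous_of_finiteDimensional
  have hπc : Continuous π := π.continuous_of_finiteDimensional
  obtain ⟨δ, hδ, hnorm⟩ := exists_pos_mul_norm_le hC (ψ := φ ∘ₗ π) hφ
  have hcompact (t : ℝ) : IsCompact ((C : Set G) ∩ {c | φ (π c) ≤ t}) := by
    refine (isCompact_closedBall (0 : G) (t / δ)).of_isClosed_subset
      (hC.inter (isClosed_le (by fun_prop) continuous_const)) fun c ⟨hc, hct⟩ => ?_
    rw [mem_closedBall_zero_iff, le_div_iff₀' hδ]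
    exact (hnorm c hc).trans hct
  refine isClosed_of_closure_subset fun y hy => ?_
  have hclosed := ((hcompact (φ y + 1)).image hπc).isClosed
  have hmem : y ∈ closure (π '' ((C : Set G) ∩ {c | φ (π c) ≤ φ y + 1})) := by
    rw [mem_closure_iff] at hy ⊢
    intro U hU hyU
    obtain ⟨_, ⟨hzU, hzφ⟩, c, hc, rfl⟩ := hy (U ∩ {z | φ z < φ y + 1})
      (hU.inter (isOpen_lt hφc continuous_const)) ⟨hyU, lt_add_one (φ y)⟩
    rw [Set.mem_ofPred_eq] at hzφ
    exact ⟨_, hzU, c, ⟨hc, Set.mem_ofPred.2 hzφ.le⟩, rfl⟩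
  rw [hclosed.closure_eq] at hmem
  exact Set.image_mono Set.inter_subset_left hmem

theorem pos_of_mem_hull {S : Set E} {φ : Dual ℝ E}
    (hφ : ∀ x ∈ S, x ≠ 0 → 0 < φ x) {x : E} (hx : x ∈ PointedCone.hull ℝ S) (hx0 : x ≠ 0) :
    0 < φ x := by
  suffices x = 0 ∨ 0 < φ x from this.resolve_left hx0
  clear hx0
  induction hx using Submodule.span_induction with
  | mem x hx => exact or_iff_not_imp_left.2 (hφ x hx)
  | zero => exact .inl rfl
  | add x y _ _ hx hy =>
    rcases hx with rfl | hx
    · rwa [zero_add]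
    · rcases hy with rfl | hy
      · rw [add_zero]
        exact .inr hx
      · rw [map_add]
        exact .inr (add_pos hx hy)
  | smul a x _ hx =>
    change (a : ℝ) • x = 0 ∨ 0 < φ ((a : ℝ) • x)
    rcases hx with rfl | hx
    · exact .inl (smul_zero _)
    · rcases a.2.eq_or_lt with ha | ha
      · exact .inl (by rw [← ha, zero_smul])
      · rw [map_smul]
        exact .inr (mul_pos ha hx)

theorem isExposedFace_bot_of_forall_pos {C : PointedCone ℝ E} {φ : Dual ℝ E}
    (hφ : ∀ c ∈ C, c ≠ 0 → 0 < φ c) : IsExposedFace ⊥ C := by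
  refine ⟨φ, fun c hc => ?_, ?_⟩
  · rcases eq_or_ne c 0 with rfl | hc0
    · simp
    · exact (hφ c hc hc0).le
  · ext c
    refine ⟨fun hc => ?_, fun ⟨hc, hφc⟩ => by_contra fun hc0 => (hφ c hc hc0).ne' hφc⟩
    obtain rfl : c = 0 := hc
    exact ⟨C.zero_mem, map_zero φ⟩

theorem IsAlmostCompact.exists_forall_pos {C : PointedCone ℝ E} (hC : IsAlmostCompact C) :
    ∃ φ : Dual ℝ E, ∀ c ∈ C, c ≠ 0 → 0 < φ c := by
  obtain ⟨φ, hφ, hbot⟩ := hC.pointed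
  exact ⟨φ, fun c hc hc0 => (hφ c hc).lt_of_ne' fun h => hc0 (hbot.symm.subset ⟨hc, h⟩)⟩

theorem IsAlmostCompact.map {C : PointedCone ℝ E} (hC : IsAlmostCompact C) {π : E →ₗ[ℝ] F}
    (hπ : Function.Surjective π) {φ : Dual ℝ F} (hφ : ∀ c ∈ C, c ≠ 0 → 0 < φ (π c)) :
    IsAlmostCompact (C.map π) where
  finite := have := hC.finite; Module.Finite.of_surjective π hπ
  pointed := by
    refine isExposedFace_bot_of_forall_pos (φ := φ) fun d hd hd0 => ?_
    obtain ⟨c, hc, rfl⟩ := PointedCone.mem_map.1 hd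
    exact hφ c hc fun hc0 => hd0 (by rw [hc0, map_zero])
  closed := by
    have := hC.finite
    have := Module.Finite.of_surjective π hπ
    let := coordNormedAddCommGroup E
    let := coordNormedSpace E
    let := coordNormedAddCommGroup F
    let := coordNormedSpace F
    have : IsModuleTopology ℝ E := isModuleTopology_of_finiteDimensional
    have : IsModuleTopology ℝ F := isModuleTopology_of_finiteDimensional
    have hclosed := hC.closed
    rw [← eq_moduleTopology ℝ E] at hclosed
    rw [← eq_moduleTopology ℝ F, PointedCone.coe_map]
    exact isClosed_image_of_forall_pos hclosed π hφ
  full := by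
    rw [PointedCone.coe_map, Submodule.span_image, hC.full, Submodule.map_top,
      LinearMap.range_eq_top.2 hπ]

end ClosedCones

section LinearMatrixInequalities

variable {E F : Type*} [AddCommGroup E] [Module ℝ E] [AddCommGroup F] [Module ℝ F]
  {ι κ : Type*}

theorem isClosed_posSemidefCone [Finite ι] : IsClosed (posSemidefCone ι : Set (Matrix ι ι ℝ)) := by
  cases nonempty_fintype ι
  have hset : (posSemidefCone ι : Set (Matrix ι ι ℝ)) = {A | A.conjTranspose = A} ∩
      ⋂ x : ι → ℝ, {A | 0 ≤ star x ⬝ᵥ (A.mulVec x)} := by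
    ext A
    change A.PosSemidef ↔ _
    simp [Matrix.posSemidef_iff_dotProduct_mulVec, Matrix.IsHermitian]
  rw [hset]
  refine (isClosed_eq (by fun_prop) (by fun_prop)).inter (isClosed_iInter fun x => ?_)
  exact isClosed_le continuous_const (by fun_prop)

theorem isAlmostCompact_comap_posSemidefCone [FiniteDimensional ℝ E] [Finite ι]
    {M : E →ₗ[ℝ] Matrix ι ι ℝ} (hM : Function.Injective M)
    (hspan : Submodule.span ℝ ((posSemidefCone ι).comap M : Set E) = ⊤) :
    IsAlmostCompact ((posSemidefCone ι).comap M) where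
  finite := inferInstance
  pointed := by
    cases nonempty_fintype ι
    refine isExposedFace_bot_of_forall_pos (φ := Matrix.traceLinearMap ι ℝ ℝ ∘ₗ M)
      fun x (hx : (M x).PosSemidef) hx0 => hx.trace_nonneg.lt_of_ne' ?_
    rw [Ne, hx.trace_eq_zero_iff]
    exact (map_ne_zero_iff M hM).2 hx0
  closed := by
    let : TopologicalSpace E := moduleTopology ℝ E
    have : IsModuleTopology ℝ E := ⟨rfl⟩
    exact isClosed_posSemidefCone.preimage (IsModuleTopology.continuous_of_linearMap M)
  full := hspan

theorem posSemidef_reindex_iff {A : Matrix ι ι ℝ} (e : ι ≃ κ) :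
    (Matrix.reindexLinearEquiv ℝ ℝ e e A).PosSemidef ↔ A.PosSemidef :=
  Matrix.posSemidef_submatrix_equiv e.symm

theorem isSpectrahedralCone_comap_posSemidefCone [FiniteDimensional ℝ E] [Finite ι]
    {M : E →ₗ[ℝ] Matrix ι ι ℝ} (hM : Function.Injective M) (hsymm : ∀ x, (M x).IsSymm)
    (hspan : Submodule.span ℝ ((posSemidefCone ι).comap M : Set E) = ⊤) :
    IsSpectrahedralCone ((posSemidefCone ι).comap M) := by
  refine ⟨isAlmostCompact_comap_posSemidefCone hM hspan, Nat.card ι, ?_⟩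
  let r := Matrix.reindexLinearEquiv ℝ ℝ (Finite.equivFin ι) (Finite.equivFin ι)
  let b := (Pi.basisFun ℝ (Fin (Nat.card ι))).dualBasis
  have hψ (x : E) : symMat b (matSym b (r (M x))) = r (M x) :=
    symMat_matSym b ((hsymm x).submatrix (Finite.equivFin ι).symm)
  refine ⟨matSym b ∘ₗ r.toLinearMap ∘ₗ M, fun x y hxy => hM (r.injective ?_), ?_⟩
  · rw [← hψ, ← hψ y]
    exact congrArg (symMat b) hxy
  · ext x
    rw [psdCone_eq_comap_symMat b]
    change _ ↔ (symMat b (matSym b (r (M x)))).PosSemidef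
    rw [hψ, posSemidef_reindex_iff]
    rfl

theorem IsSpectrahedralCone.exists_eq_comap {C : PointedCone ℝ E} (hC : IsSpectrahedralCone C) :
    ∃ (k : ℕ) (M : E →ₗ[ℝ] Matrix (Fin k) (Fin k) ℝ), Function.Injective M ∧
      (∀ x, (M x).IsSymm) ∧ C = (posSemidefCone (Fin k)).comap M := by
  obtain ⟨-, k, ψ, hψ, rfl⟩ := hC
  let b := (Pi.basisFun ℝ (Fin k)).dualBasis
  refine ⟨k, symMat b ∘ₗ ψ, (symMat_injective b).comp hψ, fun x => isSymm_symMat b _, ?_⟩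
  rw [psdCone_eq_comap_symMat b]
  rfl

theorem IsSpectrahedralCone.isSpectrahedron {C : PointedCone ℝ E} (hC : IsSpectrahedralCone C) :
    IsSpectrahedron (C : Set E) := by
  obtain ⟨k, M, -, hsymm, rfl⟩ := hC.exists_eq_comap
  refine ⟨k, 0, M, Matrix.isSymm_zero, hsymm, ?_⟩
  simp only [zero_add]
  rfl

theorem isSpectrahedralCone_psdCone (V : Type*) [AddCommGroup V] [Module ℝ V]
    [FiniteDimensional ℝ V] : IsSpectrahedralCone (psdCone V) := by
  let b := finBasis ℝ V
  have hspan := span_psdCone (V := V)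
  rw [psdCone_eq_comap_symMat b] at hspan ⊢
  exact isSpectrahedralCone_comap_posSemidefCone (symMat_injective b) (isSymm_symMat b) hspan

theorem IsSpectrahedralCone.comap_linearEquiv {C : PointedCone ℝ E} (hC : IsSpectrahedralCone C)
    (e : F ≃ₗ[ℝ] E) : IsSpectrahedralCone (C.comap e.toLinearMap) := by
  have := hC.1.finite
  have := e.symm.finiteDimensional
  have hspan : Submodule.span ℝ (C.comap e.toLinearMap : Set F) = ⊤ := by
    have himage : (C.comap e.toLinearMap : Set F) = e.symm.toLinearMap '' C :=
      (e.symm.toEquiv.image_eq_preimage_symm _).symm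
    rw [himage, Submodule.span_image, hC.1.full, Submodule.map_top, LinearEquiv.range]
  obtain ⟨k, M, hM, hsymm, rfl⟩ := hC.exists_eq_comap
  exact isSpectrahedralCone_comap_posSemidefCone (M := M ∘ₗ e.toLinearMap) (hM.comp e.injective)
    (fun x => hsymm _) hspan

theorem IsSpectrahedralCone.isSDRCone_map {C : PointedCone ℝ E} (hC : IsSpectrahedralCone C)
    {π : E →ₗ[ℝ] F} (hD : IsAlmostCompact (C.map π)) : IsSDRCone (C.map π) := by
  have := hC.1.finite
  let e := (finBasis ℝ E).equivFun
  refine ⟨hD, finrank ℝ E, C.comap e.symm.toLinearMap, π ∘ₗ e.symm.toLinearMap,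
    hC.comap_linearEquiv e.symm, ?_⟩
  ext y
  simp only [PointedCone.mem_map, PointedCone.mem_comap]
  exact (e.symm.surjective.exists (p := fun x => x ∈ C ∧ π x = y)).symm

theorem posSemidef_fromBlocks_zero_iff [Finite ι] [Finite κ] {A : Matrix ι ι ℝ}
    {D : Matrix κ κ ℝ} :
    (Matrix.fromBlocks A 0 0 D).PosSemidef ↔ A.PosSemidef ∧ D.PosSemidef := by
  cases nonempty_fintype ι
  cases nonempty_fintype κ
  refine ⟨fun h => ⟨h.submatrix Sum.inl, h.submatrix Sum.inr⟩, fun ⟨hA, hD⟩ => ?_⟩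
  refine Matrix.PosSemidef.of_dotProduct_mulVec_nonneg
    (Matrix.IsHermitian.fromBlocks hA.1 (by simp) hD.1) fun x => ?_
  have hAx := hA.dotProduct_mulVec_nonneg (x ∘ Sum.inl)
  have hDx := hD.dotProduct_mulVec_nonneg (x ∘ Sum.inr)
  simp only [dotProduct, Fintype.sum_sum_type, Matrix.fromBlocks_mulVec] at hAx hDx ⊢
  simpa using add_nonneg hAx hDx

/-- The block diagonal matrix with blocks `A`, `diag r` and `- diag r`. It is positive semidefinite
if and only if `A` is and `r = 0`, so it encodes linear equations in a linear matrix inequality. -/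
def constrainedMat [DecidableEq κ] :
    Matrix ι ι ℝ × (κ → ℝ) →ₗ[ℝ] Matrix (ι ⊕ (κ ⊕ κ)) (ι ⊕ (κ ⊕ κ)) ℝ where
  toFun p := Matrix.fromBlocks p.1 0 0 (Matrix.diagonal (Sum.elim p.2 (-p.2)))
  map_add' p q := by
    rw [Matrix.fromBlocks_add, Matrix.diagonal_add, add_zero, add_zero]
    congr 2
    ext (i | i) <;> simp [add_comm]
  map_smul' c p := by
    rw [Matrix.fromBlocks_smul, ← Matrix.diagonal_smul, smul_zero, smul_zero]
    congr 2
    ext (i | i) <;> simp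

theorem posSemidef_constrainedMat_iff [Finite ι] [Finite κ] [DecidableEq κ] {A : Matrix ι ι ℝ}
    {r : κ → ℝ} : (constrainedMat (A, r)).PosSemidef ↔ A.PosSemidef ∧ r = 0 := by
  refine posSemidef_fromBlocks_zero_iff.trans (and_congr_right fun _ => ?_)
  rw [Matrix.posSemidef_diagonal_iff]
  simp [le_antisymm_iff, Pi.le_def, and_comm]

theorem isSymm_constrainedMat [DecidableEq κ] {A : Matrix ι ι ℝ} (hA : A.IsSymm) (r : κ → ℝ) :
    (constrainedMat (A, r)).IsSymm :=
  Matrix.IsSymm.fromBlocks hA (by simp) (Matrix.isSymm_diagonal _)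

theorem IsSDRCone.isSDRSet {D : PointedCone ℝ E} (hD : IsSDRCone D) : IsSDRSet (D : Set E) := by
  obtain ⟨hD, l, C, π, hC, rfl⟩ := hD
  obtain ⟨k, M, -, hsymm, rfl⟩ := hC.exists_eq_comap
  have := hD.finite
  let g := (finBasis ℝ E).equivFun
  let j := Fintype.equivFin (Fin k ⊕ (Fin (finrank ℝ E) ⊕ Fin (finrank ℝ E)))
  let r := Matrix.reindexLinearEquiv ℝ ℝ j j
  refine ⟨_, l, 0, r.toLinearMap ∘ₗ constrainedMat ∘ₗ LinearMap.prod 0 (-g.toLinearMap),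
    r.toLinearMap ∘ₗ constrainedMat ∘ₗ LinearMap.prod M (g.toLinearMap ∘ₗ π),
    Matrix.isSymm_zero, fun x => (isSymm_constrainedMat Matrix.isSymm_zero _).submatrix j.symm,
    fun y => (isSymm_constrainedMat (hsymm y) _).submatrix j.symm, ?_⟩
  ext x
  refine PointedCone.mem_map.trans (exists_congr fun y => ?_)
  have hsum : 0 + r (constrainedMat (0, -g x)) + r (constrainedMat (M y, g (π y))) =
      r (constrainedMat (M y, g (π y - x))) := by
    rw [zero_add, ← map_add, ← map_add, Prod.mk_add_mk, zero_add, map_sub, neg_add_eq_sub]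
  change (M y).PosSemidef ∧ π y = x ↔
    (0 + r (constrainedMat (0, -g x)) + r (constrainedMat (M y, g (π y)))).PosSemidef
  rw [hsum, posSemidef_reindex_iff, posSemidef_constrainedMat_iff, map_eq_zero_iff g g.injective,
    sub_eq_zero]

end LinearMatrixInequalities

section TensorProducts

open scoped Kronecker

variable {E F : Type*} [AddCommGroup E] [Module ℝ E] [AddCommGroup F] [Module ℝ F]

theorem map_hull (f : E →ₗ[ℝ] F) (S : Set E) :
    (PointedCone.hull ℝ S).map f = PointedCone.hull ℝ (f '' S) := by
  simp [PointedCone.map, PointedCone.hull, Submodule.map_span]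

theorem minTensorProduct_hull (S : Set E) (T : Set F) :
    (PointedCone.hull ℝ S).minTensorProduct (PointedCone.hull ℝ T) =
      PointedCone.hull ℝ (.image2 (· ⊗ₜ[ℝ] ·) S T) := by
  refine le_antisymm ?_ <| Submodule.span_mono <|
    Set.image2_subset Submodule.subset_span Submodule.subset_span
  rw [PointedCone.minTensorProduct, PointedCone.hull, Submodule.span_le]
  rintro _ ⟨x, hx, y, hy, rfl⟩
  have hleft : ∀ t ∈ T, PointedCone.hull ℝ S ≤
      (PointedCone.hull ℝ (.image2 (· ⊗ₜ[ℝ] ·) S T)).comap ((TensorProduct.mk ℝ E F).flip t) :=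
    fun t ht => Submodule.span_le.2 fun s hs => Submodule.subset_span ⟨s, hs, t, ht, rfl⟩
  have hright : PointedCone.hull ℝ T ≤
      (PointedCone.hull ℝ (.image2 (· ⊗ₜ[ℝ] ·) S T)).comap (TensorProduct.mk ℝ E F x) :=
    Submodule.span_le.2 fun t ht => hleft t ht hx
  exact hright hy

variable {V W : Type*} [AddCommGroup V] [Module ℝ V] [AddCommGroup W] [Module ℝ W]

theorem minTensorProduct_psdCone_eq_hull : (psdCone V).minTensorProduct (psdCone W) =
    PointedCone.hull ℝ
      (Set.range fun p : V × W => symMul p.1 p.1 ⊗ₜ[ℝ] symMul p.2 p.2) := by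
  rw [psdCone_eq_hull, psdCone_eq_hull, minTensorProduct_hull, Set.image2_range]

theorem span_minTensorProduct_psdCone :
    Submodule.span ℝ ((psdCone V).minTensorProduct (psdCone W) :
      Set (Sym[ℝ]^2 V ⊗[ℝ] Sym[ℝ]^2 W)) = ⊤ := by
  rw [eq_top_iff, ← TensorProduct.map₂_mk_top_top_eq_top, ← span_psdCone, ← span_psdCone,
    Submodule.map₂_span_span]
  exact Submodule.span_mono <| PointedCone.tmul_subset_minTensorProduct _ _

variable {ι κ : Type*} [Fintype ι] [Fintype κ] [DecidableEq ι] [DecidableEq κ]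

/-- The matrix of an element of `Sym² V ⊗ Sym² W`, as a symmetric form on the dual of `V ⊗ W`. -/
def tensorMat (b : Basis ι ℝ V) (c : Basis κ ℝ W) :
    Sym[ℝ]^2 V ⊗[ℝ] Sym[ℝ]^2 W →ₗ[ℝ] Matrix (ι × κ) (ι × κ) ℝ :=
  (kroneckerLinearEquiv ι ι κ κ ℝ).toLinearMap ∘ₗ TensorProduct.map (symMat b) (symMat c)

theorem tensorMat_tmul (b : Basis ι ℝ V) (c : Basis κ ℝ W) (x : Sym[ℝ]^2 V) (y : Sym[ℝ]^2 W) :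
    tensorMat b c (x ⊗ₜ y) = symMat b x ⊗ₖ symMat c y := rfl

theorem tensorMat_injective (b : Basis ι ℝ V) (c : Basis κ ℝ W) :
    Function.Injective (tensorMat b c) :=
  (kroneckerLinearEquiv ι ι κ κ ℝ).injective.comp <|
    TensorProduct.map_injective_of_flat_flat _ _ (symMat_injective b) (symMat_injective c)

theorem isSymm_tensorMat (b : Basis ι ℝ V) (c : Basis κ ℝ W) (z : Sym[ℝ]^2 V ⊗[ℝ] Sym[ℝ]^2 W) :
    (tensorMat b c z).IsSymm := by
  induction z using TensorProduct.induction_on with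
  | zero => exact Matrix.isSymm_zero
  | tmul x y =>
    rw [tensorMat_tmul, Matrix.IsSymm, ← Matrix.kroneckerMap_transpose, isSymm_symMat,
      isSymm_symMat]
  | add y z hy hz => rw [map_add]; exact hy.add hz

theorem isPartialTransposeInvariant_tensorMat (b : Basis ι ℝ V) (c : Basis κ ℝ W)
    (z : Sym[ℝ]^2 V ⊗[ℝ] Sym[ℝ]^2 W) : IsPartialTransposeInvariant (tensorMat b c z) := by
  intro i j k l
  induction z using TensorProduct.induction_on with
  | zero => rfl
  | tmul x y => exact congrArg (· * _) ((isSymm_symMat b x).apply j i)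
  | add y z hy hz => rw [map_add, Matrix.add_apply, hy, hz, Matrix.add_apply]

theorem map_tensorMat_minTensorProduct (b : Basis ι ℝ V) (c : Basis κ ℝ W) :
    ((psdCone V).minTensorProduct (psdCone W)).map (tensorMat b c) = sepCone ι κ := by
  have hrange : (tensorMat b c ∘ fun p : V × W => symMul p.1 p.1 ⊗ₜ[ℝ] symMul p.2 p.2) =
      (fun p : (ι → ℝ) × (κ → ℝ) => Matrix.vecMulVec p.1 p.1 ⊗ₖ Matrix.vecMulVec p.2 p.2) ∘
        Prod.map b.equivFun c.equivFun := by
    ext1 p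
    simp [tensorMat_tmul, symMat_symMul_self]
  rw [minTensorProduct_psdCone_eq_hull, map_hull, ← Set.range_comp, hrange,
    (b.equivFun.surjective.prodMap c.equivFun.surjective).range_comp, sepCone]

theorem posSemidef_tensorMat (b : Basis ι ℝ V) (c : Basis κ ℝ W) {z : Sym[ℝ]^2 V ⊗[ℝ] Sym[ℝ]^2 W}
    (hz : z ∈ (psdCone V).minTensorProduct (psdCone W)) : (tensorMat b c z).PosSemidef := by
  have hsep : tensorMat b c z ∈ sepCone ι κ :=
    map_tensorMat_minTensorProduct b c ▸ PointedCone.mem_map.2 ⟨z, hz, rfl⟩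
  exact sepCone_le_posSemidefCone hsep

theorem minTensorProduct_psdCone_eq_comap {m n : ℕ} (hmn : min m n ≤ 2) (b : Basis (Fin m) ℝ V)
    (c : Basis (Fin n) ℝ W) : (psdCone V).minTensorProduct (psdCone W) =
      (posSemidefCone (Fin m × Fin n)).comap (tensorMat b c) := by
  refine le_antisymm (fun z hz => posSemidef_tensorMat b c hz) fun z hz => ?_
  have hsep : tensorMat b c z ∈ ((psdCone V).minTensorProduct (psdCone W)).map (tensorMat b c) :=
    map_tensorMat_minTensorProduct b c ▸
      mem_sepCone_of_min_le_two hmn hz (isPartialTransposeInvariant_tensorMat b c z)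
  obtain ⟨z', hz', hzz'⟩ := PointedCone.mem_map.1 hsep
  rwa [← tensorMat_injective b c hzz']

theorem isSpectrahedralCone_minTensorProduct [FiniteDimensional ℝ V] [FiniteDimensional ℝ W]
    (h : min (finrank ℝ V) (finrank ℝ W) ≤ 2) :
    IsSpectrahedralCone ((psdCone V).minTensorProduct (psdCone W)) := by
  have hcomap := minTensorProduct_psdCone_eq_comap h (finBasis ℝ V) (finBasis ℝ W)
  rw [hcomap]
  exact isSpectrahedralCone_comap_posSemidefCone (tensorMat_injective _ _) (isSymm_tensorMat _ _)
    (hcomap ▸ span_minTensorProduct_psdCone)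

end TensorProducts

section PositiveMaps

open scoped Kronecker Matrix

variable {V W : Type*} [AddCommGroup V] [Module ℝ V] [AddCommGroup W] [Module ℝ W]

theorem mem_homCone_psdCone_iff {f : Sym[ℝ]^2 V →ₗ[ℝ] Sym[ℝ]^2 W} :
    f ∈ homCone (psdCone V) (psdCone W) ↔ ∀ v, f (symMul v v) ∈ psdCone W := by
  refine ⟨fun hf v => hf _ (symMul_self_mem_psdCone v), fun hf => ?_⟩
  suffices psdCone V ≤ (psdCone W).comap f from this
  rw [psdCone_eq_hull, PointedCone.hull, Submodule.span_le]
  rintro _ ⟨v, rfl⟩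
  exact hf v

/-- The map `Sym² V → Sym² W` induced by the product of two linear maps `f` and `g`, that is, the
polarization of `f ↦ Sym² f`. It sends `v²` to `(f v) (g v)`. -/
def symProd (f g : V →ₗ[ℝ] W) : Sym[ℝ]^2 V →ₗ[ℝ] Sym[ℝ]^2 W :=
  symLift ((1 / 2 : ℝ) • (symMul.compl₁₂ f g + symMul.compl₁₂ g f)) fun x y => by
    simp only [LinearMap.smul_apply, LinearMap.add_apply, LinearMap.compl₁₂_apply]
    rw [symMul_comm (f x), symMul_comm (g x), add_comm]

theorem symProd_symMul_self (f g : V →ₗ[ℝ] W) (v : V) :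
    symProd f g (symMul v v) = symMul (f v) (g v) := by
  simp only [symProd, symLift_symMul, LinearMap.smul_apply, LinearMap.add_apply,
    LinearMap.compl₁₂_apply, symMul_comm (g v)]
  module

/-- The linear extension of `f ↦ Sym² f` to the symmetric square of the space of linear maps. -/
def symSquareMap : Sym[ℝ]^2 (V →ₗ[ℝ] W) →ₗ[ℝ] Sym[ℝ]^2 V →ₗ[ℝ] Sym[ℝ]^2 W :=
  symLift
    (LinearMap.mk₂ ℝ symProd
      (fun f f' g => symmetricSquare_hom_ext fun v => by simp [symProd_symMul_self])
      (fun a f g => symmetricSquare_hom_ext fun v => by simp [symProd_symMul_self])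
      (fun f g g' => symmetricSquare_hom_ext fun v => by simp [symProd_symMul_self])
      (fun a f g => symmetricSquare_hom_ext fun v => by simp [symProd_symMul_self]))
    fun f g => symmetricSquare_hom_ext fun v => by
      simp only [LinearMap.mk₂_apply, symProd_symMul_self, symMul_comm (f v)]

theorem symSquareMap_symMul_apply (f g : V →ₗ[ℝ] W) (v : V) :
    symSquareMap (symMul f g) (symMul v v) = symMul (f v) (g v) := by
  simp [symSquareMap, symProd_symMul_self]

theorem map_symSquareMap_le_homCone :
    (psdCone (V →ₗ[ℝ] W)).map symSquareMap ≤ homCone (psdCone V) (psdCone W) := by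
  rw [psdCone_eq_hull (V := V →ₗ[ℝ] W), map_hull, PointedCone.hull, Submodule.span_le]
  rintro _ ⟨_, ⟨f, rfl⟩, rfl⟩
  refine mem_homCone_psdCone_iff.2 fun v => ?_
  rw [symSquareMap_symMul_apply]
  exact symMul_self_mem_psdCone (f v)

variable {ι κ : Type*} [Fintype κ]

/-- The Choi matrix of a linear map `f : Sym² V → Sym² W`, whose blocks are the matrices of the
elements `f (bᵢ bⱼ)`. -/
def choiMatrix (b : Basis ι ℝ V) (c : Basis κ ℝ W) :
    (Sym[ℝ]^2 V →ₗ[ℝ] Sym[ℝ]^2 W) →ₗ[ℝ] Matrix (κ × ι) (κ × ι) ℝ where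
  toFun f := Matrix.of fun p q => symMat c (f (symMul (b p.2) (b q.2))) p.1 q.1
  map_add' f g := by ext; simp
  map_smul' a f := by ext; simp

theorem choiMatrix_apply (b : Basis ι ℝ V) (c : Basis κ ℝ W)
    (f : Sym[ℝ]^2 V →ₗ[ℝ] Sym[ℝ]^2 W) (k l : κ) (i j : ι) :
    choiMatrix b c f (k, i) (l, j) = symMat c (f (symMul (b i) (b j))) k l := rfl

variable [Fintype ι]

theorem symMul_self_eq_sum (b : Basis ι ℝ V) (v : V) : symMul v v =
    ∑ i, ∑ j, (b.equivFun v i * b.equivFun v j) • symMul (b i) (b j) := by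
  rw [← matSym_symMat b (symMul v v), symMat_symMul_self]
  rfl

theorem sum_choiMatrix_mul_nonneg (b : Basis ι ℝ V) (c : Basis κ ℝ W)
    {f : Sym[ℝ]^2 V →ₗ[ℝ] Sym[ℝ]^2 W} (hf : f ∈ homCone (psdCone V) (psdCone W))
    {σ : Matrix (κ × ι) (κ × ι) ℝ} (hσ : σ ∈ sepCone κ ι) :
    0 ≤ ∑ p, ∑ q, choiMatrix b c f p q * σ p q := by
  let pairing : Matrix (κ × ι) (κ × ι) ℝ →ₗ[ℝ] ℝ :=
    ∑ p, ∑ q, choiMatrix b c f p q • Matrix.entryLinearMap ℝ ℝ p q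
  suffices sepCone κ ι ≤ (PointedCone.positive ℝ ℝ).comap pairing by
    simpa [pairing] using this hσ
  rw [sepCone, PointedCone.hull, Submodule.span_le]
  rintro _ ⟨⟨y, x⟩, rfl⟩
  have hform : pairing (Matrix.vecMulVec y y ⊗ₖ Matrix.vecMulVec x x) =
      y ⬝ᵥ symMat c (f (symMul (b.equivFun.symm x) (b.equivFun.symm x))) *ᵥ y := by
    rw [symMul_self_eq_sum b, LinearEquiv.apply_symm_apply]
    simp only [pairing, dotProduct, Matrix.mulVec, map_sum, map_smul, LinearMap.sum_apply,
      LinearMap.smul_apply, Matrix.sum_apply, Matrix.smul_apply, smul_eq_mul,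
      Fintype.sum_prod_type, Matrix.entryLinearMap_apply, Matrix.kroneckerMap_apply,
      Matrix.vecMulVec_apply, choiMatrix_apply, Finset.mul_sum, Finset.sum_mul]
    refine Finset.sum_congr rfl fun k _ => Finset.sum_comm.trans ?_
    refine Finset.sum_congr rfl fun l _ => Finset.sum_congr rfl fun i _ =>
      Finset.sum_congr rfl fun j _ => ?_
    ring
  change 0 ≤ pairing (Matrix.vecMulVec y y ⊗ₖ Matrix.vecMulVec x x)
  rw [hform]
  exact ((mem_psdCone_iff c _).1 (mem_homCone_psdCone_iff.1 hf _)).dotProduct_mulVec_nonneg y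

theorem trace_choiMatrix_pos (b : Basis ι ℝ V) (c : Basis κ ℝ W) {s : Sym[ℝ]^2 (V →ₗ[ℝ] W)}
    (hs : s ∈ psdCone (V →ₗ[ℝ] W)) (hs0 : s ≠ 0) : 0 < (choiMatrix b c (symSquareMap s)).trace := by
  rw [psdCone_eq_hull] at hs
  refine pos_of_mem_hull
    (φ := Matrix.traceLinearMap (κ × ι) ℝ ℝ ∘ₗ choiMatrix b c ∘ₗ symSquareMap) ?_ hs hs0
  rintro _ ⟨f, rfl⟩ hf
  have htrace : (choiMatrix b c (symSquareMap (symMul f f))).trace =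
      ∑ p : κ × ι, c.equivFun (f (b p.2)) p.1 ^ 2 := by
    refine Finset.sum_congr rfl fun p _ => ?_
    rw [Matrix.diag_apply, choiMatrix_apply, symSquareMap_symMul_apply, symMat_symMul_self,
      Matrix.vecMulVec_apply, sq]
  change 0 < (choiMatrix b c (symSquareMap (symMul f f))).trace
  rw [htrace]
  refine (Finset.sum_nonneg fun p _ => sq_nonneg _).lt_of_ne fun hzero => hf ?_
  suffices hf0 : f = 0 by simp only [hf0, map_zero]
  refine b.ext fun i => c.equivFun.map_eq_zero_iff.1 <| funext fun k => ?_
  rw [eq_comm, Finset.sum_eq_zero_iff_of_nonneg fun p _ => sq_nonneg _] at hzero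
  exact pow_eq_zero_iff two_ne_zero |>.1 (hzero (k, i) (Finset.mem_univ _))

variable [DecidableEq ι]

theorem symSquareMap_linearMap_apply (b : Basis ι ℝ V) (c : Basis κ ℝ W) (k l : κ) (i j : ι)
    (v : V) : symSquareMap (symMul (b.linearMap c (k, i)) (b.linearMap c (l, j))) (symMul v v) =
      (b.equivFun v i * b.equivFun v j) • symMul (c k) (c l) := by
  have happly (k : κ) (i : ι) : b.linearMap c (k, i) = (b.coord i).smulRight (c k) := by
    refine b.ext fun j => ?_
    rw [Basis.linearMap_apply_apply, LinearMap.smulRight_apply, Basis.coord_apply,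
      Basis.repr_self, Finsupp.single_apply, ite_smul, one_smul, zero_smul]
    simp only [eq_comm]
  simp only [symSquareMap_symMul_apply, happly, LinearMap.smulRight_apply, map_smul,
    LinearMap.smul_apply, smul_smul, Basis.coord_apply, Basis.equivFun_apply, mul_comm]

theorem sum_choiMatrix_smul (b : Basis ι ℝ V) (c : Basis κ ℝ W)
    (f : Sym[ℝ]^2 V →ₗ[ℝ] Sym[ℝ]^2 W) :
    ∑ p, ∑ q, choiMatrix b c f p q • symSquareMap (symMul (b.linearMap c p) (b.linearMap c q)) =
      f := by
  refine symmetricSquare_hom_ext fun v => ?_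
  have hexpand (i j : ι) : f (symMul (b i) (b j)) =
      ∑ k, ∑ l, choiMatrix b c f (k, i) (l, j) • symMul (c k) (c l) :=
    (matSym_symMat c _).symm
  conv_rhs => rw [symMul_self_eq_sum b v]
  simp only [LinearMap.sum_apply, LinearMap.smul_apply, Fintype.sum_prod_type,
    symSquareMap_linearMap_apply, map_sum, map_smul, hexpand, Finset.smul_sum, smul_smul]
  calc _ = ∑ i, ∑ k, ∑ l, ∑ j, (choiMatrix b c f (k, i) (l, j) *
        (b.equivFun v i * b.equivFun v j)) • symMul (c k) (c l) := Finset.sum_comm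
    _ = _ := Finset.sum_congr rfl fun i _ =>
      (Finset.sum_congr rfl fun k _ => Finset.sum_comm).trans Finset.sum_comm
    _ = _ := by simp only [mul_comm]

theorem symSquareMap_surjective [FiniteDimensional ℝ V] [FiniteDimensional ℝ W] :
    Function.Surjective (symSquareMap (V := V) (W := W)) := fun f => by
  rw [← LinearMap.mem_range, ← sum_choiMatrix_smul (finBasis ℝ V) (finBasis ℝ W) f]
  exact Submodule.sum_mem _ fun p _ => Submodule.sum_mem _ fun q _ =>
    Submodule.smul_mem _ _ (LinearMap.mem_range_self _ _)

/-- The Gram matrix of the symmetric bilinear form that a functional `l` on the space of linear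
maps `Sym² V → Sym² W` induces on the space of linear maps `V → W`. -/
def gramMatrix (b : Basis ι ℝ V) (c : Basis κ ℝ W) (l : Dual ℝ (Sym[ℝ]^2 V →ₗ[ℝ] Sym[ℝ]^2 W)) :
    Matrix (κ × ι) (κ × ι) ℝ :=
  Matrix.of fun p q => l (symSquareMap (symMul (b.linearMap c p) (b.linearMap c q)))

theorem apply_eq_sum_choiMatrix_mul_gramMatrix (b : Basis ι ℝ V) (c : Basis κ ℝ W)
    (l : Dual ℝ (Sym[ℝ]^2 V →ₗ[ℝ] Sym[ℝ]^2 W)) (f : Sym[ℝ]^2 V →ₗ[ℝ] Sym[ℝ]^2 W) :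
    l f = ∑ p, ∑ q, choiMatrix b c f p q * gramMatrix b c l p q := by
  conv_lhs => rw [← sum_choiMatrix_smul b c f]
  simp [gramMatrix]

theorem isPartialTransposeInvariant_gramMatrix (b : Basis ι ℝ V) (c : Basis κ ℝ W)
    (l : Dual ℝ (Sym[ℝ]^2 V →ₗ[ℝ] Sym[ℝ]^2 W)) :
    IsPartialTransposeInvariant (gramMatrix b c l) := fun k k' i j => by
  refine congrArg l (symmetricSquare_hom_ext fun v => ?_)
  rw [symSquareMap_linearMap_apply, symSquareMap_linearMap_apply, symMul_comm]

theorem posSemidef_gramMatrix (b : Basis ι ℝ V) (c : Basis κ ℝ W)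
    {l : Dual ℝ (Sym[ℝ]^2 V →ₗ[ℝ] Sym[ℝ]^2 W)}
    (hl : ∀ f ∈ (psdCone (V →ₗ[ℝ] W)).map symSquareMap, 0 ≤ l f) :
    (gramMatrix b c l).PosSemidef := by
  refine Matrix.PosSemidef.of_dotProduct_mulVec_nonneg ?_ fun x => ?_
  · ext p q
    exact congrArg (l ∘ symSquareMap) (symMul_comm _ _)
  · have hgram : star x ⬝ᵥ gramMatrix b c l *ᵥ x = l (symSquareMap
        (symMul (∑ p, x p • b.linearMap c p) (∑ p, x p • b.linearMap c p))) := by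
      simp only [map_sum, map_smul, LinearMap.sum_apply, LinearMap.smul_apply, dotProduct,
        Matrix.mulVec, gramMatrix, Matrix.of_apply, star_trivial, smul_eq_mul, Finset.mul_sum]
      rw [Finset.sum_comm]
      exact Finset.sum_congr rfl fun q _ => Finset.sum_congr rfl fun p _ => by ring
    rw [hgram]
    exact hl _ <| PointedCone.mem_map.2 ⟨_, symMul_self_mem_psdCone _, rfl⟩

variable [FiniteDimensional ℝ V] [FiniteDimensional ℝ W]

theorem isAlmostCompact_map_symSquareMap :
    IsAlmostCompact ((psdCone (V →ₗ[ℝ] W)).map symSquareMap) :=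
  (isSpectrahedralCone_psdCone (V →ₗ[ℝ] W)).1.map symSquareMap_surjective
    (φ := Matrix.traceLinearMap _ ℝ ℝ ∘ₗ choiMatrix (finBasis ℝ V) (finBasis ℝ W)) fun _ hs hs0 =>
      trace_choiMatrix_pos _ _ hs hs0

theorem homCone_psdCone_eq_map (h : min (finrank ℝ V) (finrank ℝ W) ≤ 2) :
    homCone (psdCone V) (psdCone W) = (psdCone (V →ₗ[ℝ] W)).map symSquareMap := by
  refine le_antisymm (fun f hf => ?_) map_symSquareMap_le_homCone
  by_contra hnot
  obtain ⟨l, hl, hlf⟩ := exists_dual_neg_of_notMem isAlmostCompact_map_symSquareMap.closed hnot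
  refine hlf.not_ge ?_
  rw [apply_eq_sum_choiMatrix_mul_gramMatrix (finBasis ℝ V) (finBasis ℝ W)]
  exact sum_choiMatrix_mul_nonneg _ _ hf <| mem_sepCone_of_min_le_two (min_comm (finrank ℝ V) _ ▸ h)
    (posSemidef_gramMatrix _ _ hl) (isPartialTransposeInvariant_gramMatrix _ _ _)

theorem isSDRCone_homCone_psdCone (h : min (finrank ℝ V) (finrank ℝ W) ≤ 2) :
    IsSDRCone (homCone (psdCone V) (psdCone W)) := by
  rw [homCone_psdCone_eq_map h]
  exact (isSpectrahedralCone_psdCone _).isSDRCone_map isAlmostCompact_map_symSquareMap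

end PositiveMaps

section SymmetricPowers

variable {E : Type*} [AddCommGroup E] [Module ℝ E]

/-- The multiplication map from the tensor square to the symmetric square. -/
def tensorToSym : E ⊗[ℝ] E →ₗ[ℝ] Sym[ℝ]^2 E := TensorProduct.lift symMul

theorem tensorToSym_tmul (x y : E) : tensorToSym (x ⊗ₜ y) = symMul x y := by
  simp [tensorToSym]

theorem tensorToSym_surjective : Function.Surjective (tensorToSym (E := E)) := by
  rw [← LinearMap.range_eq_top, eq_top_iff, ← span_range_symMul_self, Submodule.span_le]
  rintro _ ⟨x, rfl⟩
  exact ⟨x ⊗ₜ x, tensorToSym_tmul x x⟩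

theorem map_tensorToSym (C : PointedCone ℝ E) :
    (C.minTensorProduct C).map tensorToSym = symPower 2 C := by
  rw [PointedCone.minTensorProduct, map_hull, symPower, Set.image_image2]
  congr 1
  ext s
  simp only [Set.mem_image2, tensorToSym_tmul, tprod_eq_symMul, Set.mem_ofPred_eq,
    Fin.forall_fin_two, SetLike.mem_coe]
  constructor
  · rintro ⟨x, hx, y, hy, rfl⟩
    exact ⟨![x, y], ⟨hx, hy⟩, rfl⟩
  · rintro ⟨v, ⟨hv₀, hv₁⟩, rfl⟩
    exact ⟨v 0, hv₀, v 1, hv₁, rfl⟩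

theorem exists_forall_pos_tensorToSym {C : PointedCone ℝ E} (hC : IsAlmostCompact C) :
    ∃ φ : Dual ℝ (Sym[ℝ]^2 E), ∀ z ∈ C.minTensorProduct C, z ≠ 0 → 0 < φ (tensorToSym z) := by
  obtain ⟨τ, hτ⟩ := hC.exists_forall_pos
  let φ : Dual ℝ (Sym[ℝ]^2 E) :=
    symLift ((LinearMap.mul ℝ ℝ).compl₁₂ τ τ) fun x y => mul_comm (τ x) (τ y)
  have hφ (x y : E) : φ (symMul x y) = τ x * τ y := symLift_symMul _ _ x y
  refine ⟨φ, fun z hz hz0 => pos_of_mem_hull (φ := φ ∘ₗ tensorToSym) ?_ hz hz0⟩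
  rintro _ ⟨x, hx, y, hy, rfl⟩ hxy
  rw [LinearMap.comp_apply, tensorToSym_tmul, hφ]
  exact mul_pos (hτ x hx fun h => hxy (by simp only [h, TensorProduct.zero_tmul]))
    (hτ y hy fun h => hxy (by simp only [h, TensorProduct.tmul_zero]))

theorem IsAlmostCompact.isSDRCone_symPower {C : PointedCone ℝ E} (hC : IsAlmostCompact C)
    (hCC : IsSpectrahedralCone (C.minTensorProduct C)) : IsSDRCone (symPower 2 C) := by
  obtain ⟨φ, hφ⟩ := exists_forall_pos_tensorToSym hC
  rw [← map_tensorToSym]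
  exact hCC.isSDRCone_map (hCC.1.map tensorToSym_surjective hφ)

end SymmetricPowers

section Faces

open scoped Matrix

variable {E : Type*} [AddCommGroup E] [Module ℝ E]

theorem nonneg_of_add_nonneg_of_smul {a b : ℝ} (h : ∀ r : ℝ, 0 ≤ r → 0 ≤ a + r * b) : 0 ≤ b := by
  by_contra! hb
  have hr := h ((a ^ 2 + 1) / -b) (by have := neg_pos.2 hb; positivity)
  rw [div_mul_eq_mul_div, mul_comm, div_neg, mul_div_cancel_left₀ _ hb.ne] at hr
  nlinarith [sq_nonneg (a - 1)]

/-- The smallest face of a cone that contains the point `z` of the cone. -/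
def minimalFace (C : PointedCone ℝ E) (z : E) (hz : z ∈ C) : PointedCone ℝ E where
  carrier := {c | c ∈ C ∧ ∃ t : ℝ, 0 < t ∧ z - t • c ∈ C}
  zero_mem' := ⟨C.zero_mem, 1, one_pos, by simpa using hz⟩
  add_mem' := by
    rintro x y ⟨hx, t, ht, hxt⟩ ⟨hy, s, hs, hys⟩
    have hsum : z - (t * s / (t + s)) • (x + y) =
        (s / (t + s)) • (z - t • x) + (t / (t + s)) • (z - s • y) := by
      match_scalars <;> field_simp
      ring
    refine ⟨C.add_mem hx hy, t * s / (t + s), by positivity, ?_⟩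
    rw [hsum]
    exact C.add_mem (C.smul_mem (r := s / (t + s)) (by positivity) hxt)
      (C.smul_mem (r := t / (t + s)) (by positivity) hys)
  smul_mem' := by
    rintro ⟨a, ha⟩ x ⟨hx, t, ht, hxt⟩
    refine ⟨C.smul_mem ha hx, ?_⟩
    change ∃ t : ℝ, 0 < t ∧ z - t • (a • x) ∈ C
    rcases ha.eq_or_lt with rfl | ha
    · exact ⟨1, one_pos, by simpa using hz⟩
    · refine ⟨t / a, by positivity, ?_⟩
      rwa [smul_smul, div_mul_cancel₀ _ ha.ne']

variable {C : PointedCone ℝ E} {z : E}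

theorem mem_minimalFace_self (hz : z ∈ C) : z ∈ minimalFace C z hz :=
  ⟨hz, 1, one_pos, by simp⟩

theorem isFaceOf_minimalFace (hz : z ∈ C) : (minimalFace C z hz).IsFaceOf C where
  le _ hx := hx.1
  mem_of_smul_add_mem := by
    rintro x y a hx hy ha ⟨-, t, ht, h⟩
    refine ⟨hx, t * a, by positivity, ?_⟩
    have hsplit : z - (t * a) • x = (z - t • (a • x + y)) + t • y := by module
    rw [hsplit]
    exact C.add_mem h (C.smul_mem ht.le hy)

theorem not_isExposedFace_minimalFace (hz : z ∈ C) {q : E} (hq : q ∈ C)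
    (hzq : ∀ φ : Dual ℝ E, (∀ c ∈ C, 0 ≤ φ c) → φ z = 0 → φ q = 0)
    (hsub : ∀ t : ℝ, 0 < t → z - t • q ∉ C) : ¬ IsExposedFace (minimalFace C z hz) C := by
  rintro ⟨φ, hφ, hface⟩
  have hφz : φ z = 0 := (hface.le (mem_minimalFace_self hz)).2
  obtain ⟨-, t, ht, htq⟩ : q ∈ minimalFace C z hz := hface.ge ⟨hq, hzq φ hφ hφz⟩
  exact hsub t ht htq

theorem IsSpectrahedron.exists_eq_comap (hC : IsSpectrahedron (C : Set E)) :
    ∃ (k : ℕ) (B : E →ₗ[ℝ] Matrix (Fin k) (Fin k) ℝ),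
      (∀ x, (B x).IsSymm) ∧ C = (posSemidefCone (Fin k)).comap B := by
  obtain ⟨k, A, B, -, hB, hset⟩ := hC
  have hmem (x : E) : x ∈ C ↔ (A + B x).PosSemidef := Set.ext_iff.1 hset x
  have hA : A.PosSemidef := by simpa using (hmem 0).1 C.zero_mem
  refine ⟨k, B, hB, le_antisymm (fun x hx => ?_) fun x hx => (hmem x).2 (hA.add hx)⟩
  refine Matrix.PosSemidef.of_dotProduct_mulVec_nonneg ?_ fun u =>
    nonneg_of_add_nonneg_of_smul (a := star u ⬝ᵥ A *ᵥ u) fun r hr => ?_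
  · exact (Matrix.conjTranspose_eq_transpose_of_trivial _).trans (hB x)
  · have hray := ((hmem (r • x)).1 (C.smul_mem hr hx)).dotProduct_mulVec_nonneg u
    rwa [map_smul, Matrix.add_mulVec, dotProduct_add, Matrix.smul_mulVec, dotProduct_smul] at hray

theorem exists_dual_posSemidef_eq_zero_iff {ι : Type*} [Fintype ι] (A : Matrix ι ι ℝ) :
    ∃ φ : Dual ℝ (Matrix ι ι ℝ), ∀ M : Matrix ι ι ℝ, M.PosSemidef →
      0 ≤ φ M ∧ (φ M = 0 ↔ ∀ v, A *ᵥ v = 0 → M *ᵥ v = 0) := by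
  let u := finBasis ℝ A.mulVecLin.ker
  let φ : Dual ℝ (Matrix ι ι ℝ) :=
    { toFun := fun M => ∑ j, (u j : ι → ℝ) ⬝ᵥ M *ᵥ (u j : ι → ℝ)
      map_add' := fun M N => by simp [Matrix.add_mulVec, Finset.sum_add_distrib]
      map_smul' := fun r M => by simp [Matrix.smul_mulVec, Finset.mul_sum] }
  have hφ_apply (M) : φ M = ∑ j, (u j : ι → ℝ) ⬝ᵥ M *ᵥ (u j : ι → ℝ) := rfl
  have hspan : Submodule.span ℝ (Set.range fun j => (u j : ι → ℝ)) = A.mulVecLin.ker := by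
    have hmap := congrArg (Submodule.map A.mulVecLin.ker.subtype) u.span_eq
    rwa [Submodule.map_span, ← Set.range_comp, Submodule.map_subtype_top] at hmap
  refine ⟨φ, fun M hM => ?_⟩
  have hnonneg (j) : 0 ≤ (u j : ι → ℝ) ⬝ᵥ M *ᵥ (u j : ι → ℝ) := hM.dotProduct_mulVec_nonneg _
  rw [hφ_apply]
  refine ⟨Finset.sum_nonneg fun j _ => hnonneg j, fun hzero v hv => ?_, fun hker => ?_⟩
  · have hbasis (j) : M *ᵥ (u j : ι → ℝ) = 0 :=
      (hM.dotProduct_mulVec_zero_iff _).1 <|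
        (Finset.sum_eq_zero_iff_of_nonneg fun j _ => hnonneg j).1 hzero j (Finset.mem_univ j)
    have hle : A.mulVecLin.ker ≤ M.mulVecLin.ker := by
      rw [← hspan, Submodule.span_le]
      rintro _ ⟨j, rfl⟩
      exact hbasis j
    exact hle hv
  · exact Finset.sum_eq_zero fun j _ => by rw [hker _ (u j).2, dotProduct_zero]

theorem IsSpectrahedron.isExposedFace_minimalFace (hC : IsSpectrahedron (C : Set E)) (hz : z ∈ C) :
    IsExposedFace (minimalFace C z hz) C := by
  obtain ⟨k, B, hB, rfl⟩ := hC.exists_eq_comap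
  obtain ⟨φ, hφ⟩ := exists_dual_posSemidef_eq_zero_iff (B z)
  have hφz : φ (B z) = 0 := (hφ _ hz).2.2 fun _ => id
  refine ⟨φ ∘ₗ B, fun x hx => (hφ _ hx).1, Set.ext fun x => ⟨?_, ?_⟩⟩
  · rintro ⟨hx, t, ht, htx⟩
    have hsub : 0 ≤ φ (B (z - t • x)) := (hφ _ htx).1
    rw [map_sub, map_sub, map_smul, map_smul, hφz, zero_sub, smul_eq_mul,
      Left.nonneg_neg_iff] at hsub
    exact ⟨hx, le_antisymm (nonpos_of_mul_nonpos_right hsub ht) (hφ _ hx).1⟩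
  · rintro ⟨hx, hφx⟩
    obtain ⟨t, ht, hsub⟩ := exists_posSemidef_sub_smul (A := B z) hz (hB x) ((hφ _ hx).2.1 hφx)
    rw [← map_smul, ← map_sub] at hsub
    exact ⟨hx, t, ht, hsub⟩

end Faces

section WeightedCauchySchwarz

variable {ι : Type*} [Fintype ι] {D x y : ι → ℝ} {k : ℝ}

theorem sum_mul_sub_div_sq (hD : ∀ i, D i ≠ 0) (x y : ι → ℝ) (k : ℝ) :
    ∑ i, D i * (y i - k * (∑ j, x j * y j) * x i / D i) ^ 2 =
      (∑ i, D i * y i ^ 2 - k * (∑ i, x i * y i) ^ 2) -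
        k * (∑ i, x i * y i) ^ 2 * (1 - k * ∑ i, x i ^ 2 / D i) := by
  set s := ∑ i, x i * y i with hs
  have hterm (i) : D i * (y i - k * s * x i / D i) ^ 2 =
      D i * y i ^ 2 - 2 * k * s * (x i * y i) + k ^ 2 * s ^ 2 * (x i ^ 2 / D i) := by
    field_simp [hD i]
    ring
  simp only [hterm, Finset.sum_add_distrib, Finset.sum_sub_distrib, ← Finset.mul_sum, ← hs]
  ring

theorem mul_sum_sq_le_sum_mul_sq (hD : ∀ i, 0 < D i) (hk : 0 ≤ k)
    (h : k * ∑ i, x i ^ 2 / D i ≤ 1) : k * (∑ i, x i * y i) ^ 2 ≤ ∑ i, D i * y i ^ 2 := by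
  have hsq : 0 ≤ ∑ i, D i * (y i - k * (∑ j, x j * y j) * x i / D i) ^ 2 :=
    Finset.sum_nonneg fun i _ => mul_nonneg (hD i).le (sq_nonneg _)
  rw [sum_mul_sub_div_sq (fun i => (hD i).ne')] at hsq
  have hslack := mul_nonneg (mul_nonneg hk (sq_nonneg (∑ i, x i * y i))) (sub_nonneg.2 h)
  linarith

theorem mul_eq_of_sum_mul_sq_eq (hD : ∀ i, 0 < D i) (hk : 0 ≤ k)
    (h : k * ∑ i, x i ^ 2 / D i ≤ 1) (heq : ∑ i, D i * y i ^ 2 = k * (∑ i, x i * y i) ^ 2) (i : ι) :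
    D i * y i = k * (∑ j, x j * y j) * x i := by
  have hnonneg (i : ι) : 0 ≤ D i * (y i - k * (∑ j, x j * y j) * x i / D i) ^ 2 :=
    mul_nonneg (hD i).le (sq_nonneg _)
  have hslack := mul_nonneg (mul_nonneg hk (sq_nonneg (∑ i, x i * y i))) (sub_nonneg.2 h)
  have hsum : ∑ i, D i * (y i - k * (∑ j, x j * y j) * x i / D i) ^ 2 = 0 := by
    refine le_antisymm ?_ (Finset.sum_nonneg fun i _ => hnonneg i)
    rw [sum_mul_sub_div_sq (fun i => (hD i).ne'), heq]
    linarith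
  have hzero := (Finset.sum_eq_zero_iff_of_nonneg fun i _ => hnonneg i).1 hsum i (Finset.mem_univ i)
  have hy : y i = k * (∑ j, x j * y j) * x i / D i := by
    simpa [(hD i).ne', sub_eq_zero] using hzero
  rw [hy, mul_div_cancel₀ _ (hD i).ne']

theorem mul_sum_sq_div_eq_one (hD : ∀ i, D i ≠ 0) (hs : ∑ i, x i * y i ≠ 0)
    (h : ∀ i, D i * y i = k * (∑ j, x j * y j) * x i) : k * ∑ i, x i ^ 2 / D i = 1 := by
  refine mul_left_cancel₀ hs ?_
  calc (∑ i, x i * y i) * (k * ∑ i, x i ^ 2 / D i)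
      = ∑ i, x i * (k * (∑ j, x j * y j) * x i) / D i := by
        rw [← mul_assoc, Finset.mul_sum]
        exact Finset.sum_congr rfl fun i _ => by ring
    _ = (∑ i, x i * y i) * 1 := by
        rw [mul_one]
        exact Finset.sum_congr rfl fun i _ => by
          rw [← h, mul_left_comm, mul_div_cancel_left₀ _ (hD i)]

end WeightedCauchySchwarz

section ChoKyeLeeForm

/-- A nonnegative biquadratic form of the family of Cho, Kye and Lee; indices are taken modulo 3.
Up to scaling of `x` and `y` it has ten zeros: those of `x = y = (1, ±1, ±1)`, and the cyclic shifts
of `x = (1, ±2, 0)`, `y = (2, ±1, 0)`. -/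
def ckl (x y : Fin 3 → ℝ) : ℝ :=
  ∑ i, (9 * x i ^ 2 * y i ^ 2 + 16 * x i ^ 2 * y (i + 1) ^ 2 + x i ^ 2 * y (i + 2) ^ 2 -
    26 * x i * x (i + 1) * y i * y (i + 1))

/-- A biquadratic form that separates the zero `x = y = (1, 1, 1)` of `ckl`, where it is positive,
from the nine others, where it vanishes. -/
def cklSep (x y : Fin 3 → ℝ) : ℝ :=
  ∑ i, (3 * x i * x (i + 1) * y (i + 1) * y (i + 2) + 2 * x i * x (i + 1) * y i * y (i + 1) -
    x i ^ 2 * y i ^ 2)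

/-- The diagonal coefficients of `ckl x`, as a quadratic form in `y`, after
`13 * (∑ i, x i * y i) ^ 2` is split off. -/
def cklWeight (x : Fin 3 → ℝ) (i : Fin 3) : ℝ :=
  22 * x i ^ 2 + x (i + 1) ^ 2 + 16 * x (i + 2) ^ 2

theorem ckl_shift (x y : Fin 3 → ℝ) (k : Fin 3) :
    ckl (fun i => x (i + k)) (fun i => y (i + k)) = ckl x y := by
  unfold ckl
  rw [eq_comm, ← Equiv.sum_comp (Equiv.addRight k)]
  simp only [Equiv.coe_addRight, add_right_comm _ k]

theorem cklSep_shift (x y : Fin 3 → ℝ) (k : Fin 3) :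
    cklSep (fun i => x (i + k)) (fun i => y (i + k)) = cklSep x y := by
  unfold cklSep
  rw [eq_comm, ← Equiv.sum_comp (Equiv.addRight k)]
  simp only [Equiv.coe_addRight, add_right_comm _ k]

theorem ckl_eq_sum_cklWeight_sub (x y : Fin 3 → ℝ) :
    ckl x y = ∑ i, cklWeight x i * y i ^ 2 - 13 * (∑ i, x i * y i) ^ 2 := by
  simp only [ckl, cklWeight, Fin.sum_univ_three, zero_add, Fin.reduceAdd]
  ring

theorem cklWeight_pos {x : Fin 3 → ℝ} (hx : x ≠ 0) (i : Fin 3) : 0 < cklWeight x i := by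
  obtain ⟨j, hj⟩ := Function.ne_iff.1 hx
  have hsum : 0 < ∑ j, x j ^ 2 :=
    Finset.sum_pos' (fun j _ => sq_nonneg (x j)) ⟨j, Finset.mem_univ j, sq_pos_of_ne_zero hj⟩
  rw [← Equiv.sum_comp (Equiv.addRight i), Fin.sum_univ_three] at hsum
  simp only [Equiv.coe_addRight, add_comm _ i, add_zero] at hsum
  unfold cklWeight
  nlinarith [sq_nonneg (x i), sq_nonneg (x (i + 2))]

theorem prod_cklWeight_mul_one_sub {x : Fin 3 → ℝ} (hx : x ≠ 0) {a b : ℝ}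
    (ha : x 1 ^ 2 = x 0 ^ 2 + a) (hb : x 2 ^ 2 = x 0 ^ 2 + b) :
    (∏ i, cklWeight x i) * (1 - 13 * ∑ i, x i ^ 2 / cklWeight x i) =
      1521 * x 0 ^ 2 * (a ^ 2 - a * b + b ^ 2) + 9 * (a + 16 * b) * (4 * a - b) ^ 2 := by
  have h0 := (cklWeight_pos hx 0).ne'
  have h1 := (cklWeight_pos hx 1).ne'
  have h2 := (cklWeight_pos hx 2).ne'
  rw [Fin.prod_univ_three, Fin.sum_univ_three]
  field_simp
  simp only [cklWeight, zero_add, Fin.reduceAdd, ha, hb]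
  ring

theorem mul_sum_sq_div_cklWeight_le_one {x : Fin 3 → ℝ} (hx : x ≠ 0)
    (hmin : ∀ i, x 0 ^ 2 ≤ x i ^ 2) : 13 * ∑ i, x i ^ 2 / cklWeight x i ≤ 1 := by
  obtain ⟨a, ha0, ha⟩ := exists_nonneg_add_of_le (hmin 1)
  obtain ⟨b, hb0, hb⟩ := exists_nonneg_add_of_le (hmin 2)
  have hab : 0 ≤ a ^ 2 - a * b + b ^ 2 := by nlinarith [sq_nonneg (a - b), mul_nonneg ha0 hb0]
  have hprod : 0 < ∏ i, cklWeight x i := Finset.prod_pos fun i _ => cklWeight_pos hx i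
  refine sub_nonneg.1 (nonneg_of_mul_nonneg_right ?_ hprod)
  rw [prod_cklWeight_mul_one_sub hx ha.symm hb.symm]
  positivity

theorem sq_eq_of_mul_sum_sq_div_cklWeight_eq_one {x : Fin 3 → ℝ} (hx : x ≠ 0)
    (hmin : ∀ i, x 0 ^ 2 ≤ x i ^ 2) (h : 13 * ∑ i, x i ^ 2 / cklWeight x i = 1) :
    (x 1 ^ 2 = x 0 ^ 2 ∧ x 2 ^ 2 = x 0 ^ 2) ∨ (x 0 = 0 ∧ x 2 ^ 2 = 4 * x 1 ^ 2) := by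
  obtain ⟨a, ha0, ha⟩ := exists_nonneg_add_of_le (hmin 1)
  obtain ⟨b, hb0, hb⟩ := exists_nonneg_add_of_le (hmin 2)
  have hab : 0 ≤ a ^ 2 - a * b + b ^ 2 := by nlinarith [sq_nonneg (a - b), mul_nonneg ha0 hb0]
  have hsum := prod_cklWeight_mul_one_sub hx ha.symm hb.symm
  rw [h, sub_self, mul_zero, eq_comm, add_eq_zero_iff_of_nonneg (by positivity) (by positivity)]
    at hsum
  obtain ⟨hleft, hright⟩ := hsum
  have hba : b = 4 * a := by
    rcases mul_eq_zero.1 hright with h | h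
    · linarith
    · linarith [pow_eq_zero_iff two_ne_zero |>.1 h]
  subst hba
  rcases mul_eq_zero.1 hleft with h | h
  · have hx0 : x 0 ^ 2 = 0 := by linarith
    exact Or.inr ⟨by simpa using hx0, by rw [← ha, ← hb, hx0]; ring⟩
  · have ha' : a = 0 := pow_eq_zero_iff two_ne_zero |>.1 (by linarith : a ^ 2 = 0)
    exact Or.inl ⟨by simp [← ha, ha'], by simp [← hb, ha']⟩

theorem cklSep_smul_nonneg {x : Fin 3 → ℝ} (h₁ : x 1 ^ 2 = x 0 ^ 2) (h₂ : x 2 ^ 2 = x 0 ^ 2)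
    (r : ℝ) : 0 ≤ cklSep x (r • x) := by
  have hsq : cklSep x (r • x) = 3 / 4 * (r * ((x 0 + x 1) * (x 0 + x 2))) ^ 2 := by
    simp only [cklSep, Pi.smul_apply, smul_eq_mul, Fin.sum_univ_three, zero_add, Fin.reduceAdd]
    grind
  rw [hsq]
  positivity

theorem cklSep_eq_zero {x y : Fin 3 → ℝ} (hx : x 0 = 0) (hy : y 0 = 0)
    (h : x 1 * y 1 = x 2 * y 2) : cklSep x y = 0 := by
  have hsq : cklSep x y = -(x 1 * y 1 - x 2 * y 2) ^ 2 := by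
    simp only [cklSep, Fin.sum_univ_three, zero_add, Fin.reduceAdd, hx, hy]
    ring
  simp [hsq, h]

theorem exists_shift_sq_le {x : Fin 3 → ℝ} (hx : x ≠ 0) :
    ∃ k, (fun i => x (i + k)) ≠ 0 ∧ ∀ i, x (0 + k) ^ 2 ≤ x (i + k) ^ 2 := by
  obtain ⟨k, hk⟩ := Finite.exists_min fun i => x i ^ 2
  refine ⟨k, fun h => hx (funext fun i => ?_), fun i => by simpa using hk (i + k)⟩
  simpa using congrFun h (i - k)

theorem ckl_nonneg (x y : Fin 3 → ℝ) : 0 ≤ ckl x y := by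
  rcases eq_or_ne x 0 with rfl | hx
  · simp [ckl]
  obtain ⟨k, hxk, hk⟩ := exists_shift_sq_le hx
  rw [← ckl_shift x y k, ckl_eq_sum_cklWeight_sub, sub_nonneg]
  exact mul_sum_sq_le_sum_mul_sq (cklWeight_pos hxk) (by norm_num)
    (mul_sum_sq_div_cklWeight_le_one hxk hk)

theorem cklSep_nonneg_of_min {x y : Fin 3 → ℝ} (hx : x ≠ 0) (hmin : ∀ i, x 0 ^ 2 ≤ x i ^ 2)
    (h : ckl x y = 0) : 0 ≤ cklSep x y := by
  have hD := cklWeight_pos hx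
  have hy := mul_eq_of_sum_mul_sq_eq hD (by norm_num) (mul_sum_sq_div_cklWeight_le_one hx hmin)
    (sub_eq_zero.1 ((ckl_eq_sum_cklWeight_sub x y).symm.trans h))
  set s := ∑ i, x i * y i
  rcases eq_or_ne s 0 with hs0 | hs0
  · have hy0 : y = 0 := funext fun i => by simpa [hs0, (hD i).ne'] using hy i
    simp [cklSep, hy0]
  rcases sq_eq_of_mul_sum_sq_div_cklWeight_eq_one hx hmin
    (mul_sum_sq_div_eq_one (fun i => (hD i).ne') hs0 hy) with ⟨h₁, h₂⟩ | ⟨h₀, h₂⟩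
  · have hweight (i) : cklWeight x i = cklWeight x 0 := by
      fin_cases i <;> simp [cklWeight, h₁, h₂]
    have hyx : y = (13 * s / cklWeight x 0) • x := funext fun i => by
      rw [Pi.smul_apply, smul_eq_mul, div_mul_eq_mul_div, ← hy, hweight,
        mul_div_cancel_left₀ _ (hD 0).ne']
    rw [hyx]
    exact cklSep_smul_nonneg h₁ h₂ _
  · have hy₀ : y 0 = 0 := by simpa [h₀, (hD 0).ne'] using hy 0
    have hD₂ : cklWeight x 2 = 4 * cklWeight x 1 := by
      simp only [cklWeight, Fin.reduceAdd, h₀, h₂]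
      ring
    refine (cklSep_eq_zero h₀ hy₀ (mul_left_cancel₀ (hD 2).ne' ?_)).ge
    calc cklWeight x 2 * (x 1 * y 1) = 4 * x 1 * (cklWeight x 1 * y 1) := by rw [hD₂]; ring
      _ = 13 * s * x 2 ^ 2 := by rw [hy, h₂]; ring
      _ = cklWeight x 2 * (x 2 * y 2) := by rw [mul_left_comm, hy]; ring

theorem cklSep_nonneg_of_ckl_eq_zero {x y : Fin 3 → ℝ} (h : ckl x y = 0) : 0 ≤ cklSep x y := by
  rcases eq_or_ne x 0 with rfl | hx
  · simp [cklSep]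
  obtain ⟨k, hxk, hk⟩ := exists_shift_sq_le hx
  rw [← cklSep_shift x y k]
  exact cklSep_nonneg_of_min hxk hk ((ckl_shift x y k).trans h)

end ChoKyeLeeForm

section NonexposedFace

open scoped Kronecker

theorem lex_nonneg_of_mem_hull {E : Type*} [AddCommGroup E] [Module ℝ E] {S : Set E}
    {φ ψ : Dual ℝ E} (h : ∀ x ∈ S, 0 ≤ φ x ∧ (φ x = 0 → 0 ≤ ψ x)) {x : E}
    (hx : x ∈ PointedCone.hull ℝ S) : 0 ≤ φ x ∧ (φ x = 0 → 0 ≤ ψ x) := by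
  induction hx using Submodule.span_induction with
  | mem x hx => exact h x hx
  | zero => simp
  | add x y _ _ hx hy =>
    rw [map_add, map_add]
    refine ⟨add_nonneg hx.1 hy.1, fun hxy => ?_⟩
    obtain ⟨hx0, hy0⟩ := (add_eq_zero_iff_of_nonneg hx.1 hy.1).1 hxy
    exact add_nonneg (hx.2 hx0) (hy.2 hy0)
  | smul a x _ hx =>
    obtain ⟨a, ha⟩ := a
    change 0 ≤ φ (a • x) ∧ (φ (a • x) = 0 → 0 ≤ ψ (a • x))
    rw [map_smul, map_smul, smul_eq_mul, smul_eq_mul]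
    refine ⟨mul_nonneg ha hx.1, fun hax => ?_⟩
    rcases mul_eq_zero.1 hax with rfl | hx0
    · rw [zero_mul]
    · exact mul_nonneg ha (hx.2 hx0)

/-- The functional on matrices that corresponds to the biquadratic form `ckl`. -/
def cklDual : Dual ℝ (Matrix (Fin 3 × Fin 3) (Fin 3 × Fin 3) ℝ) :=
  ∑ i, ((9 : ℝ) • Matrix.entryLinearMap ℝ ℝ (i, i) (i, i) +
    (16 : ℝ) • Matrix.entryLinearMap ℝ ℝ (i, i + 1) (i, i + 1) +
    Matrix.entryLinearMap ℝ ℝ (i, i + 2) (i, i + 2) -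
    (26 : ℝ) • Matrix.entryLinearMap ℝ ℝ (i, i) (i + 1, i + 1))

/-- The functional on matrices that corresponds to the biquadratic form `cklSep`. -/
def cklSepDual : Dual ℝ (Matrix (Fin 3 × Fin 3) (Fin 3 × Fin 3) ℝ) :=
  ∑ i, ((3 : ℝ) • Matrix.entryLinearMap ℝ ℝ (i, i + 1) (i + 1, i + 2) +
    (2 : ℝ) • Matrix.entryLinearMap ℝ ℝ (i, i) (i + 1, i + 1) -
    Matrix.entryLinearMap ℝ ℝ (i, i) (i, i))

theorem cklDual_kronecker (x y : Fin 3 → ℝ) :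
    cklDual (Matrix.vecMulVec x x ⊗ₖ Matrix.vecMulVec y y) = ckl x y := by
  simp only [cklDual, ckl, LinearMap.sum_apply, LinearMap.sub_apply, LinearMap.add_apply,
    LinearMap.smul_apply, Matrix.entryLinearMap_apply, Matrix.kroneckerMap_apply,
    Matrix.vecMulVec_apply, smul_eq_mul]
  exact Finset.sum_congr rfl fun i _ => by ring

theorem cklSepDual_kronecker (x y : Fin 3 → ℝ) :
    cklSepDual (Matrix.vecMulVec x x ⊗ₖ Matrix.vecMulVec y y) = cklSep x y := by
  simp only [cklSepDual, cklSep, LinearMap.sum_apply, LinearMap.sub_apply, LinearMap.add_apply,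
    LinearMap.smul_apply, Matrix.entryLinearMap_apply, Matrix.kroneckerMap_apply,
    Matrix.vecMulVec_apply, smul_eq_mul]
  exact Finset.sum_congr rfl fun i _ => by ring

theorem cklSepDual_nonneg_of_cklDual_eq_zero {M : Matrix (Fin 3 × Fin 3) (Fin 3 × Fin 3) ℝ}
    (hM : M ∈ sepCone (Fin 3) (Fin 3)) (h : cklDual M = 0) : 0 ≤ cklSepDual M := by
  refine (lex_nonneg_of_mem_hull ?_ hM).2 h
  rintro _ ⟨p, rfl⟩
  simp only [cklDual_kronecker, cklSepDual_kronecker]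
  exact ⟨ckl_nonneg _ _, cklSep_nonneg_of_ckl_eq_zero⟩

/-- The first components of the zeros of `ckl` other than `x = y = (1, 1, 1)`: three vectors and
their cyclic shifts. -/
def cklZeroLeft (p : Fin 3 × Fin 3) (i : Fin 3) : ℤ :=
  ![![1, 1, -1], ![1, 2, 0], ![1, -2, 0]] p.1 (i + p.2)

/-- The second components of the zeros of `ckl` other than `x = y = (1, 1, 1)`. -/
def cklZeroRight (p : Fin 3 × Fin 3) (i : Fin 3) : ℤ :=
  ![![1, 1, -1], ![2, 1, 0], ![2, -1, 0]] p.1 (i + p.2)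

/-- The first components of tangent directions at the zeros `cklZeroLeft`, `cklZeroRight` of `ckl`,
chosen so that the tangent vectors add up to a multiple of the tensor of the remaining zero. -/
def cklTangentLeft (p : Fin 3 × Fin 3) (i : Fin 3) : ℤ :=
  ![![3, 15, 17], ![-6, 0, 6], ![6, 0, 2]] p.1 (i + p.2)

/-- The second components of the tangent directions of `cklTangentLeft`. -/
def cklTangentRight (p : Fin 3 × Fin 3) (i : Fin 3) : ℤ :=
  ![![15, 3, 17], ![0, -6, 6], ![0, -6, -2]] p.1 (i + p.2)

theorem ckl_cklZero (p : Fin 3 × Fin 3) :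
    ckl (fun i => cklZeroLeft p i) (fun i => cklZeroRight p i) = 0 := by
  obtain ⟨t, k⟩ := p
  have hshift := ckl_shift (fun i => cklZeroLeft (t, 0) i) (fun i => cklZeroRight (t, 0) i) k
  simp only [cklZeroLeft, cklZeroRight, add_zero] at hshift ⊢
  rw [hshift]
  fin_cases t <;> simp [ckl, Fin.sum_univ_three] <;> norm_num

theorem cklSep_cklZero (p : Fin 3 × Fin 3) :
    cklSep (fun i => cklZeroLeft p i) (fun i => cklZeroRight p i) = 0 := by
  obtain ⟨t, k⟩ := p
  have hshift := cklSep_shift (fun i => cklZeroLeft (t, 0) i) (fun i => cklZeroRight (t, 0) i) k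
  simp only [cklZeroLeft, cklZeroRight, add_zero] at hshift ⊢
  rw [hshift]
  fin_cases t <;> simp [cklSep, Fin.sum_univ_three] <;> norm_num

theorem sum_cklTangent : ∀ i j k l : Fin 3, ∑ p,
    ((cklZeroLeft p i * cklTangentLeft p j + cklTangentLeft p i * cklZeroLeft p j) *
        (cklZeroRight p k * cklZeroRight p l) +
      cklZeroLeft p i * cklZeroLeft p j *
        (cklZeroRight p k * cklTangentRight p l + cklTangentRight p k * cklZeroRight p l)) = 4 := by
  decide +kernel

variable {V W : Type*} [AddCommGroup V] [Module ℝ V] [AddCommGroup W] [Module ℝ W]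

theorem dual_symMul_eq_zero {φ : Dual ℝ (Sym[ℝ]^2 V)} (hφ : ∀ v, 0 ≤ φ (symMul v v)) {v : V}
    (hv : φ (symMul v v) = 0) (x : V) : φ (symMul v x) = 0 := by
  let B : LinearMap.BilinForm ℝ V := symMul.compr₂ φ
  have hB : LinearMap.IsSymm B := ⟨fun x y => congrArg φ (symMul_comm x y)⟩
  have hsq : φ (symMul v x) ^ 2 ≤ φ (symMul v v) * φ (symMul x x) :=
    B.apply_sq_le_of_symm hφ hB v x
  rw [hv, zero_mul] at hsq
  exact pow_eq_zero_iff two_ne_zero |>.1 (le_antisymm hsq (sq_nonneg _))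

/-- The extreme ray `v² ⊗ w²` of the cone `S₊(V) ⊗ S₊(W)`. -/
def sqTmul (v : V) (w : W) : Sym[ℝ]^2 V ⊗[ℝ] Sym[ℝ]^2 W := symMul v v ⊗ₜ symMul w w

/-- Half of the derivative of `sqTmul` at `(v, w)` in the direction `(x, y)`. -/
def sqTmulTangent (v : V) (w : W) (x : V) (y : W) : Sym[ℝ]^2 V ⊗[ℝ] Sym[ℝ]^2 W :=
  symMul v x ⊗ₜ symMul w w + symMul v v ⊗ₜ symMul w y

theorem sqTmul_mem (v : V) (w : W) : sqTmul v w ∈ (psdCone V).minTensorProduct (psdCone W) :=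
  PointedCone.tmul_mem_minTensorProduct (symMul_self_mem_psdCone v) (symMul_self_mem_psdCone w)

theorem dual_sqTmulTangent_eq_zero {φ : Dual ℝ (Sym[ℝ]^2 V ⊗[ℝ] Sym[ℝ]^2 W)}
    (hφ : ∀ v w, 0 ≤ φ (sqTmul v w)) {v : V} {w : W} (h : φ (sqTmul v w) = 0) (x : V) (y : W) :
    φ (sqTmulTangent v w x y) = 0 := by
  have hleft : φ (symMul v x ⊗ₜ symMul w w) = 0 :=
    dual_symMul_eq_zero (φ := φ ∘ₗ (TensorProduct.mk ℝ _ _).flip (symMul w w))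
      (fun v => hφ v w) h x
  have hright : φ (symMul v v ⊗ₜ symMul w y) = 0 :=
    dual_symMul_eq_zero (φ := φ ∘ₗ TensorProduct.mk ℝ _ _ (symMul v v)) (hφ v) h y
  rw [sqTmulTangent, map_add, hleft, hright, add_zero]

theorem tensorMat_sqTmul {ι κ : Type*} [Fintype ι] [Fintype κ] [DecidableEq ι] [DecidableEq κ]
    (b : Basis ι ℝ V) (c : Basis κ ℝ W) (u : ι → ℝ) (v : κ → ℝ) :
    tensorMat b c (sqTmul (b.equivFun.symm u) (c.equivFun.symm v)) =
      Matrix.vecMulVec u u ⊗ₖ Matrix.vecMulVec v v := by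
  simp only [sqTmul, tensorMat_tmul, symMat_symMul_self,
    LinearEquiv.apply_symm_apply]

variable (b : Basis (Fin 3) ℝ V) (c : Basis (Fin 3) ℝ W)

/-- The sum of the tensors of all zeros of `ckl` but `x = y = (1, 1, 1)`. -/
def cklZeroSum : Sym[ℝ]^2 V ⊗[ℝ] Sym[ℝ]^2 W :=
  ∑ p, sqTmul (b.equivFun.symm fun i => cklZeroLeft p i) (c.equivFun.symm fun i => cklZeroRight p i)

theorem cklZeroSum_mem : cklZeroSum b c ∈ (psdCone V).minTensorProduct (psdCone W) :=
  Submodule.sum_mem _ fun _ _ => sqTmul_mem _ _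

theorem two_smul_sqTmul_one :
    (2 : ℝ) • sqTmul (b.equivFun.symm 1) (c.equivFun.symm 1) =
      ∑ p, sqTmulTangent (b.equivFun.symm fun i => cklZeroLeft p i)
        (c.equivFun.symm fun i => cklZeroRight p i) (b.equivFun.symm fun i => cklTangentLeft p i)
        (c.equivFun.symm fun i => cklTangentRight p i) := by
  apply tensorMat_injective b c
  ext ⟨i, k⟩ ⟨j, l⟩
  have h := congrArg (Int.cast : ℤ → ℝ) (sum_cklTangent i j k l)
  push_cast at h
  simp only [sqTmul, sqTmulTangent, map_smul, map_sum, map_add, Matrix.smul_apply,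
    Matrix.sum_apply, Matrix.add_apply, tensorMat_tmul, Matrix.kroneckerMap_apply, symMat_symMul,
    LinearEquiv.apply_symm_apply, Matrix.vecMulVec_apply, Pi.one_apply, smul_eq_mul]
  calc
    _ = 1 / 2 * (4 : ℝ) := by norm_num
    _ = _ := by
      rw [← h, Finset.mul_sum]
      exact Finset.sum_congr rfl fun p _ => by ring

theorem dual_sqTmul_one_eq_zero {φ : Dual ℝ (Sym[ℝ]^2 V ⊗[ℝ] Sym[ℝ]^2 W)}
    (hφ : ∀ x ∈ (psdCone V).minTensorProduct (psdCone W), 0 ≤ φ x)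
    (h : φ (cklZeroSum b c) = 0) : φ (sqTmul (b.equivFun.symm 1) (c.equivFun.symm 1)) = 0 := by
  rw [cklZeroSum, map_sum,
    Finset.sum_eq_zero_iff_of_nonneg fun p _ => hφ _ (sqTmul_mem _ _)] at h
  have htangent := congrArg φ (two_smul_sqTmul_one b c)
  rw [map_smul, map_sum, Finset.sum_eq_zero fun p hp =>
    dual_sqTmulTangent_eq_zero (fun v w => hφ _ (sqTmul_mem v w)) (h p hp) _ _] at htangent
  simpa using htangent

theorem cklZeroSum_sub_smul_notMem {t : ℝ} (ht : 0 < t) :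
    cklZeroSum b c - t • sqTmul (b.equivFun.symm 1) (c.equivFun.symm 1) ∉
      (psdCone V).minTensorProduct (psdCone W) := by
  intro hmem
  have hsep : tensorMat b c (cklZeroSum b c - t • sqTmul (b.equivFun.symm 1) (c.equivFun.symm 1)) ∈
      sepCone (Fin 3) (Fin 3) :=
    map_tensorMat_minTensorProduct b c ▸ PointedCone.mem_map.2 ⟨_, hmem, rfl⟩
  have hckl : ckl 1 1 = 0 := by norm_num [ckl, Fin.sum_univ_three]
  have hcklSep : cklSep 1 1 = 12 := by norm_num [cklSep, Fin.sum_univ_three]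
  have hnonneg := cklSepDual_nonneg_of_cklDual_eq_zero hsep (by
    simp only [cklZeroSum, map_sub, map_sum, map_smul, tensorMat_sqTmul, cklDual_kronecker,
      ckl_cklZero, hckl, Finset.sum_const_zero, smul_zero, sub_zero])
  simp only [cklZeroSum, map_sub, map_sum, map_smul, tensorMat_sqTmul, cklSepDual_kronecker,
    cklSep_cklZero, hcklSep, Finset.sum_const_zero, smul_eq_mul] at hnonneg
  linarith

end NonexposedFace

end ConeFunctors

end

theorem mainTheorem6 {V W : Type*} [AddCommGroup V] [Module ℝ V] [FiniteDimensional ℝ V]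
    [AddCommGroup W] [Module ℝ W] [FiniteDimensional ℝ W]
    (m n : ℕ) (hm : finrank ℝ V = m) (hn : finrank ℝ W = n) :
    (min m n ≤ 2 →
      (IsSpectrahedralCone ((psdCone V).minTensorProduct (psdCone W)) ∧
        IsSpectrahedron
          ((psdCone V).minTensorProduct (psdCone W) : Set (Sym[ℝ]^2 V ⊗[ℝ] Sym[ℝ]^2 W))) ∧
      (IsSDRCone (homCone (psdCone V) (psdCone W)) ∧
        IsSDRSet (homCone (psdCone V) (psdCone W) : Set (Sym[ℝ]^2 V →ₗ[ℝ] Sym[ℝ]^2 W)))) ∧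
    (m ≤ 2 →
      IsSDRCone (symPower 2 (psdCone V)) ∧
        IsSDRSet (symPower 2 (psdCone V) : Set (Sym[ℝ]^2 (Sym[ℝ]^2 V)))) ∧
    (m = 3 → n = 3 →
      (∃ F : PointedCone ℝ (Sym[ℝ]^2 V ⊗[ℝ] Sym[ℝ]^2 W),
        F.IsFaceOf ((psdCone V).minTensorProduct (psdCone W)) ∧
        ¬ IsExposedFace F ((psdCone V).minTensorProduct (psdCone W))) ∧
      ¬ IsSpectrahedron
          ((psdCone V).minTensorProduct (psdCone W) : Set (Sym[ℝ]^2 V ⊗[ℝ] Sym[ℝ]^2 W)) ∧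
      ¬ IsSpectrahedralCone ((psdCone V).minTensorProduct (psdCone W))) := by
  subst hm hn
  refine ⟨fun h => ?_, fun h => ?_, fun hV hW => ?_⟩
  · have htensor := isSpectrahedralCone_minTensorProduct h
    have hhom := isSDRCone_homCone_psdCone h
    exact ⟨⟨htensor, htensor.isSpectrahedron⟩, hhom, hhom.isSDRSet⟩
  · have htensor := isSpectrahedralCone_minTensorProduct (V := V) (W := V) (min_le_of_left_le h)
    have hsym := (isSpectrahedralCone_psdCone V).1.isSDRCone_symPower htensor
    exact ⟨hsym, hsym.isSDRSet⟩
  · let b := finBasisOfFinrankEq ℝ V hV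
    let c := finBasisOfFinrankEq ℝ W hW
    have hmem := cklZeroSum_mem b c
    have hnotExposed := not_isExposedFace_minimalFace hmem (sqTmul_mem _ _)
      (fun _ => dual_sqTmul_one_eq_zero b c) (fun _ => cklZeroSum_sub_smul_notMem b c)
    have hnot : ¬ IsSpectrahedron
        ((psdCone V).minTensorProduct (psdCone W) : Set (Sym[ℝ]^2 V ⊗[ℝ] Sym[ℝ]^2 W)) :=
      fun h => hnotExposed (h.isExposedFace_minimalFace hmem)
    exact ⟨⟨_, isFaceOf_minimalFace hmem, hnotExposed⟩, hnot, fun h => hnot h.isSpectrahedron⟩
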